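/- Let $M$ be a smooth $m$-dimensional manifold and let $\mathcal M$ be an $[n]$-manifold over $M$: a sheaf $C^\infty(\mathcal M)$ of $\mathbb N$-graded, graded commutative, associative, unital $C^\infty(M)$-algebras on $M$ which is locally freely generated by $r_i$ elements of degree $i$, $1\le i\le n$. Let $\mathcal Q$ be a homological vector field on $\mathcal M$ (a degree $1$ derivation with $\mathcal Q^2=0$) and let $\{\cdot,\cdot\}$ be a degree $-n$ Poisson bracket on $\mathcal M$. Write $|\cdot|$ for degrees. Let $\mathfrak X(\mathcal M)$ be the sheaf of graded derivations of $C^\infty(\mathcal M)$, with differential $\mathcal L_{\mathcal Q}=[\mathcal Q,\cdot]$, left action $(\xi\mathcal X)(\zeta)=\xi\,\mathcal X(\zeta)$ and right action $\mathcal X\xi=(-1)^{|\xi||\mathcal X|}\xi\mathcal X$. Let $\Omega^1(\mathcal M)$ be the dual sheaf of one-forms, with $\langle \mathrm d\xi,\mathcal X\rangle=(-1)^{|\xi|(|\mathcal X|+1)}\mathcal X(\xi)$, with right action $\omega\xi=(-1)^{|\xi|(|\omega|+1)}\xi\omega$, and with the dual operator $\mathcal L_{\mathcal Q}$, so that $\mathcal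 L_{\mathcal Q}(\mathrm d\xi)=-\mathrm d(\mathcal Q\xi)$; as a left DG module it carries the differential $\mathcal L_{\mathcal Q}$ and as a right DG module the differential $-\mathcal L_{\mathcal Q}$. Let $\sharp\colon\Omega^1(\mathcal M)\to\mathfrak X(\mathcal M)$ be the degree $-n$ map determined by $(\sharp(\mathrm d\xi_1))\xi_2=\{\xi_1,\xi_2\}$ and $\sharp(\xi\omega)=(-1)^{|\xi|}\xi\,\sharp(\omega)$. Call $(\mathcal M,\mathcal Q,\{\cdot,\cdot\})$ symplectic if $\mathcal Q$ and the bracket are compatible, that is, $\mathcal Q\{\xi_1,\xi_2\}=\{\mathcal Q\xi_1,\xi_2\}+(-1)^{|\xi_1|-n}\{\xi_1,\mathcal Q\xi_2\}$, and the Hamiltonian vector fields $\{\xi,\cdot\}$ generate the sheaf $\mathfrak X(\mathcal M)$ as a $C^\infty(\mathcal M)$-module. Then the following are equivalent: 1. $(\mathcal M,\mathcal Q,\{\cdot,\cdot\})$ is symplectic; 2. $\sharp$ is an anti-isomorphism of left DG $\mathcal M$-modules: an isomorphism of sheaves in each degree with $\sharp(\xi\omega)=(-1)^{|\xi|}\xi\sharp(\omega)$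 and $\sharp\circ\mathcal L_{\mathcal Q}=-\mathcal L_{\mathcal Q}\circ\sharp$; 3. $\sharp$ is an isomorphism of right DG $\mathcal M$-modules of degree $-n$, that is, an isomorphism of right DG modules $(\Omega^1(\mathcal M),-\mathcal L_{\mathcal Q})\to(\mathfrak X(\mathcal M)[-n],\mathcal L_{\mathcal Q})$, where the shift $\mathfrak X(\mathcal M)[-n]=\mathfrak X(\mathcal M)\otimes\mathbb R[-n]$ has the right action $(\mathcal X\otimes1)\xi=(-1)^{n|\xi|}\,\mathcal X\xi\otimes1$. In particular, if $\mathcal Q$ and the bracket are compatible, then the bracket is symplectic if and only if 2. holds, and if and only if 3. holds. -/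

import Mathlib

open TopologicalSpace
open scoped Manifold ContDiff

universe u v

noncomputable section

/-- Exponents of the ordered monomials in generators `ξ i j` (`i : Fin n`, `j : Fin (r i)`) of
degree `i + 1`: generators of odd degree occur at most once. -/
def MultiIndex {n : ℕ} (r : Fin n → ℕ) : Type :=
  {α : (i : Fin n) → Fin (r i) → ℕ // ∀ (i : Fin n) (j : Fin (r i)), Odd ((i : ℕ) + 1) → α i j ≤ 1}

/-- The ordered monomial with exponents `α`. -/
def MultiIndex.monomial {n : ℕ} {r : Fin n → ℕ} {A : Type*} [Ring A]
    (ξ : (i : Fin n) → Fin (r i) → A) (α : MultiIndex r) : A :=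
  (List.ofFn fun i => (List.ofFn fun j => ξ i j ^ α.1 i j).prod).prod

/-- An `[n]`-manifold (an `ℕ`-manifold of degree `n`) of dimension `(m; r₁, …, rₙ)` over `M`: a
sheaf of `ℕ`-graded, graded commutative, associative, unital `C^∞(M)`-algebras which is locally
freely generated by `rᵢ` elements of degree `i`, `1 ≤ i ≤ n` (`r` is indexed from `0`).

The grading is indexed by `ℤ` and vanishes in negative degrees.  As always for sheaves of graded
algebras, the sheaf axioms are those of the homogeneous components.  Local freeness says that
locally the ordered monomials in the generators, in which those of odd degree occur at most once,
form a basis over smooth functions. -/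
structure NManifold (n m : ℕ) (r : Fin n → ℕ) (M : Type u) [TopologicalSpace M]
    [ChartedSpace (EuclideanSpace ℝ (Fin m)) M] where
  /-- sections over an open set, that is, graded functions -/
  sec : Opens M → Type v
  [ring : ∀ U, Ring (sec U)]
  [algebra : ∀ U, Algebra ℝ (sec U)]
  /-- homogeneous components -/
  gr : ∀ U, ℤ → Submodule ℝ (sec U)
  [graded : ∀ U, GradedAlgebra (gr U)]
  gr_neg : ∀ U (i : ℤ), i < 0 → gr U i = ⊥
  graded_comm : ∀ U (i j : ℤ) (x y : sec U), x ∈ gr U i → y ∈ gr U j →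
    x * y = (-1 : ℝ) ^ (i * j) • (y * x)
  /-- restriction -/
  res : ∀ {U V : Opens M}, V ≤ U → sec U →ₐ[ℝ] sec V
  res_mem : ∀ {U V : Opens M} (h : V ≤ U) (i : ℤ) (x : sec U), x ∈ gr U i → res h x ∈ gr V i
  res_self : ∀ (U : Opens M) (x : sec U), res (le_refl U) x = x
  res_res : ∀ {U V W : Opens M} (h : V ≤ U) (h' : W ≤ V) (x : sec U),
    res h' (res h x) = res (h'.trans h) x
  separated : ∀ (S : Set (Opens M)) (i : ℤ) (x : sec (sSup S)), x ∈ gr (sSup S) i →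
    (∀ V (hV : V ∈ S), res (le_sSup hV) x = 0) → x = 0
  glue : ∀ (S : Set (Opens M)) (i : ℤ) (s : ∀ V : S, sec V.1), (∀ V, s V ∈ gr V.1 i) →
    (∀ V W : S, res (inf_le_left : V.1 ⊓ W.1 ≤ V.1) (s V) =
      res (inf_le_right : V.1 ⊓ W.1 ≤ W.1) (s W)) →
    ∃ x ∈ gr (sSup S) i, ∀ V : S, res (le_sSup V.2) x = s V
  /-- the structure of a sheaf of algebras over smooth functions -/
  smooth : ∀ U : Opens M, C^∞⟮𝓡 m, U; ℝ⟯ →ₐ[ℝ] sec U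
  smooth_mem : ∀ (U : Opens M) f, smooth U f ∈ gr U 0
  res_smooth : ∀ {U V : Opens M} (h : V ≤ U) f,
    res h (smooth U f) = smooth V (ContMDiffMap.restrictRingHom (𝓡 m) 𝓘(ℝ) ℝ h f)
  locally_free : ∀ p : M, ∃ U : Opens M, p ∈ U ∧ ∃ ξ : (i : Fin n) → Fin (r i) → sec U,
    (∀ (i : Fin n) (j : Fin (r i)), ξ i j ∈ gr U ((i : ℤ) + 1)) ∧
    ∀ (V : Opens M) (h : V ≤ U), Function.Bijective
      fun c : MultiIndex r →₀ C^∞⟮𝓡 m, V; ℝ⟯ =>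
        c.sum fun α f => smooth V f * MultiIndex.monomial (fun i j => res h (ξ i j)) α

namespace NManifold

attribute [instance] NManifold.ring NManifold.algebra NManifold.graded

variable {n m : ℕ} {r : Fin n → ℕ} {M : Type u} [TopologicalSpace M]
  [ChartedSpace (EuclideanSpace ℝ (Fin m)) M] (𝓜 : NManifold.{u, v} n m r M)

/-! ### Signs -/

theorem sign_congr {i j : ℤ} (h : Even (i - j)) : (-1 : ℝ) ^ i = (-1) ^ j := by
  have : i = j + (i - j) := by ring
  rw [this, zpow_add₀ (by norm_num), h.neg_one_zpow, mul_one]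

theorem sign_mul (i j : ℤ) : (-1 : ℝ) ^ i * (-1) ^ j = (-1) ^ (i + j) :=
  (zpow_add₀ (by norm_num) i j).symm

theorem neg_sign (i : ℤ) : -((-1 : ℝ) ^ i) = (-1) ^ (i + 1) := by
  rw [zpow_add₀ (by norm_num)]; simp

/-! ### Vector fields -/

/-- Families of linear endomorphisms of the spaces of functions on the open subsets of `U`. -/
abbrev Op (U : Opens M) : Type (max u v) :=
  ∀ V : {V : Opens M // V ≤ U}, (𝓜.sec V.1 →ₗ[ℝ] 𝓜.sec V.1)

variable {𝓜} in
/-- `f X`, with `(f X)(x) = f * X(x)`. -/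
def lmulOp {U : Opens M} (f : 𝓜.sec U) (X : 𝓜.Op U) : 𝓜.Op U :=
  fun V => LinearMap.mulLeft ℝ (𝓜.res V.2 f) ∘ₗ X V

/-- Sections over `U` of the degree `j` part of the sheaf of graded derivations of the structure
sheaf: vector fields of degree `j`. -/
def VF (U : Opens M) (j : ℤ) : Submodule ℝ (𝓜.Op U) where
  carrier := {X |
    (∀ V (h : V ≤ U) (i : ℤ) x, x ∈ 𝓜.gr V i → X ⟨V, h⟩ x ∈ 𝓜.gr V (j + i)) ∧
    (∀ V (h : V ≤ U) (i : ℤ) x y, x ∈ 𝓜.gr V i →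
      X ⟨V, h⟩ (x * y) = X ⟨V, h⟩ x * y + (-1 : ℝ) ^ (j * i) • (x * X ⟨V, h⟩ y)) ∧
    (∀ V W (h : V ≤ U) (h' : W ≤ V) x,
      X ⟨W, h'.trans h⟩ (𝓜.res h' x) = 𝓜.res h' (X ⟨V, h⟩ x))}
  add_mem' := by
    rintro X Y ⟨h1, h2, h3⟩ ⟨g1, g2, g3⟩
    refine ⟨fun V h i x hx => add_mem (h1 V h i x hx) (g1 V h i x hx),
      fun V h i x y hx => ?_, fun V W h h' x => ?_⟩
    · simp only [Pi.add_apply, LinearMap.add_apply, h2 V h i x y hx, g2 V h i x y hx, add_mul,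
        mul_add, smul_add]
      abel
    · simp [h3 V W h h' x, g3 V W h h' x]
  zero_mem' := by
    refine ⟨fun V h i x hx => ?_, fun V h i x y hx => ?_, fun V W h h' x => ?_⟩ <;> simp
  smul_mem' := by
    rintro c X ⟨h1, h2, h3⟩
    refine ⟨fun V h i x hx => Submodule.smul_mem _ c (h1 V h i x hx),
      fun V h i x y hx => ?_, fun V W h h' x => ?_⟩
    · simp only [Pi.smul_apply, LinearMap.smul_apply, h2 V h i x y hx, smul_add, smul_mul_assoc,
        mul_smul_comm, smul_comm c]
    · simp [h3 V W h h' x]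

variable {𝓜}

/-- Restriction of vector fields. -/
def resVF {U V : Opens M} (h : V ≤ U) {j : ℤ} (X : 𝓜.VF U j) : 𝓜.VF V j :=
  ⟨fun W => X.1 ⟨W.1, W.2.trans h⟩, fun W _ => X.2.1 W _, fun W _ => X.2.2.1 W _,
    fun W W' _ hW' => X.2.2.2 W W' _ hW'⟩

theorem lmulOp_mem {U : Opens M} {i j : ℤ} {f : 𝓜.sec U} (hf : f ∈ 𝓜.gr U i) {X : 𝓜.Op U}
    (hX : X ∈ 𝓜.VF U j) : lmulOp f X ∈ 𝓜.VF U (i + j) := by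
  obtain ⟨h1, h2, h3⟩ := hX
  refine ⟨fun V h a x hx => ?_, fun V h a x y hx => ?_, fun V W h h' x => ?_⟩
  · have := SetLike.mul_mem_graded (𝓜.res_mem h i f hf) (h1 V h a x hx)
    rw [← add_assoc] at this
    exact this
  · simp only [lmulOp, LinearMap.comp_apply, LinearMap.mulLeft_apply, h2 V h a x y hx, mul_add,
      mul_smul_comm, ← mul_assoc]
    rw [𝓜.graded_comm V i a _ x (𝓜.res_mem h i f hf) hx]
    simp only [smul_mul_assoc, smul_smul, sign_mul, add_mul, add_comm]
  · simp [lmulOp, h3 V W h h' x, 𝓜.res_res]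

/-- The left module structure on vector fields. -/
def lmulVF {U : Opens M} {i j : ℤ} (f : 𝓜.gr U i) (X : 𝓜.VF U j) : 𝓜.VF U (i + j) :=
  ⟨lmulOp f.1 X.1, lmulOp_mem f.2 X.2⟩

theorem lmulVF_apply {U : Opens M} (V : {V : Opens M // V ≤ U}) {i j : ℤ} (f : 𝓜.gr U i) (X : 𝓜.VF U j)
    (x : 𝓜.sec V.1) : (lmulVF f X).1 V x = 𝓜.res V.2 f.1 * X.1 V x := rfl

/-- The right module structure on vector fields: `X f = (-1)^{|f||X|} f X`. With this sign
`(𝔛, [Q, ·])` satisfies the right Leibniz identity for the degree of vector fields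
(`HomologicalVF.lieVF_rmulVF`). -/
def rmulVF {U : Opens M} {i j : ℤ} (X : 𝓜.VF U j) (f : 𝓜.gr U i) : 𝓜.VF U (i + j) :=
  (-1 : ℝ) ^ (i * j) • lmulVF f X

variable (𝓜) in
/-- Homological vector fields: global vector fields of degree `1` squaring to zero. -/
structure HomologicalVF where
  toVF : 𝓜.VF ⊤ 1
  sq_zero : ∀ V x, toVF.1 ⟨V, le_top⟩ (toVF.1 ⟨V, le_top⟩ x) = 0

namespace HomologicalVF

variable (Q : 𝓜.HomologicalVF)

/-- The action of `Q` on functions. -/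
def app (V : Opens M) : 𝓜.sec V →ₗ[ℝ] 𝓜.sec V := Q.toVF.1 ⟨V, le_top⟩

theorem app_mem {V : Opens M} {i : ℤ} {x : 𝓜.sec V} (hx : x ∈ 𝓜.gr V i) :
    Q.app V x ∈ 𝓜.gr V (1 + i) := Q.toVF.2.1 V le_top i x hx

theorem app_mul {V : Opens M} {i : ℤ} {x : 𝓜.sec V} (hx : x ∈ 𝓜.gr V i) (y : 𝓜.sec V) :
    Q.app V (x * y) = Q.app V x * y + (-1 : ℝ) ^ i • (x * Q.app V y) := by
  have := Q.toVF.2.2.1 V le_top i x y hx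
  rwa [one_mul] at this

theorem app_res {V W : Opens M} (h : W ≤ V) (x : 𝓜.sec V) :
    Q.app W (𝓜.res h x) = 𝓜.res h (Q.app V x) := Q.toVF.2.2.2 V W le_top h x

/-- The Lie derivative `[Q, X] = Q X - (-1)^{|X|} X Q` of vector fields: the differential of the
adjoint module. -/
def lieVF {U : Opens M} {j : ℤ} : 𝓜.VF U j →ₗ[ℝ] 𝓜.VF U (j + 1) where
  toFun X := ⟨fun V => Q.app V.1 ∘ₗ X.1 V - (-1 : ℝ) ^ j • (X.1 V ∘ₗ Q.app V.1), by
    obtain ⟨X, h1, h2, h3⟩ := X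
    refine ⟨fun V h i x hx => ?_, fun V h i x y hx => ?_, fun V W h h' x => ?_⟩
    · refine sub_mem ?_ (Submodule.smul_mem _ _ ?_)
      · have := Q.app_mem (h1 V h i x hx)
        rwa [show 1 + (j + i) = j + 1 + i by ring] at this
      · have := h1 V h _ _ (Q.app_mem hx)
        rwa [← add_assoc] at this
    · simp only [LinearMap.sub_apply, LinearMap.comp_apply, LinearMap.smul_apply,
        h2 V h i x y hx, Q.app_mul hx, map_add, map_smul, Q.app_mul (h1 V h i x hx),
        h2 V h _ _ y (Q.app_mem hx), h2 V h i x _ hx, sub_mul, mul_sub, mul_smul_comm,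
        smul_mul_assoc, smul_add, smul_sub, smul_smul, sign_mul]
      rw [sign_congr (i := j * i + i) (j := (j + 1) * i) ⟨0, by ring⟩,
        sign_congr (i := j + (i + j * i)) (j := (j + 1) * i + j) ⟨0, by ring⟩,
        sign_congr (i := j + j * (1 + i)) (j := j * i) ⟨j, by ring⟩]
      simp only [add_comm j i]
      abel
    · simp [h3 V W h h', Q.app_res]⟩
  map_add' X Y := by
    ext V x
    simp only [Submodule.coe_add, Pi.add_apply, LinearMap.sub_apply, LinearMap.comp_apply,
      LinearMap.smul_apply, LinearMap.add_apply, map_add, smul_add]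
    abel
  map_smul' c X := by
    ext V x
    simp [smul_sub, smul_comm c]

end HomologicalVF

/-! ### One-forms -/

variable (𝓜) in
/-- Families of functionals on homogeneous vector fields on the open subsets of `U`. -/
abbrev Functional (U : Opens M) : Type (max u v) :=
  ∀ (V : {V : Opens M // V ≤ U}) (j : ℤ), 𝓜.VF V.1 j →ₗ[ℝ] 𝓜.sec V.1

variable (𝓜) in
/-- Sections over `U` of the degree `p` part of the sheaf `Ω¹` of one-forms, the dual module
`Hom(𝔛, C^∞)` of the sheaf of vector fields: families of functionals of degree `p`, compatible with
restrictions, such that `η(f X) = (-1)^{p|f|} f η(X)`. -/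
def Form (U : Opens M) (p : ℤ) : Submodule ℝ (𝓜.Functional U) where
  carrier := {η |
    (∀ V (h : V ≤ U) (j : ℤ) X, η ⟨V, h⟩ j X ∈ 𝓜.gr V (p + j)) ∧
    (∀ V (h : V ≤ U) (i j : ℤ) (f : 𝓜.gr V i) (X : 𝓜.VF V j),
      η ⟨V, h⟩ (i + j) (lmulVF f X) = (-1 : ℝ) ^ (p * i) • (f.1 * η ⟨V, h⟩ j X)) ∧
    (∀ V W (h : V ≤ U) (h' : W ≤ V) (j : ℤ) (X : 𝓜.VF V j),
      η ⟨W, h'.trans h⟩ j (resVF h' X) = 𝓜.res h' (η ⟨V, h⟩ j X))}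
  add_mem' := by
    rintro η θ ⟨h1, h2, h3⟩ ⟨g1, g2, g3⟩
    refine ⟨fun V h j X => add_mem (h1 V h j X) (g1 V h j X),
      fun V h i j f X => ?_, fun V W h h' j X => ?_⟩
    · simp only [Pi.add_apply, LinearMap.add_apply, h2, g2, mul_add, smul_add]
    · simp only [Pi.add_apply, LinearMap.add_apply, h3 V W h h', g3 V W h h', map_add]
  zero_mem' := by
    refine ⟨fun V h j X => ?_, fun V h i j f X => ?_, fun V W h h' j X => ?_⟩ <;> simp
  smul_mem' := by
    rintro c η ⟨h1, h2, h3⟩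
    refine ⟨fun V h j X => Submodule.smul_mem _ c (h1 V h j X),
      fun V h i j f X => ?_, fun V W h h' j X => ?_⟩
    · simp only [Pi.smul_apply, LinearMap.smul_apply, h2, mul_smul_comm, smul_comm c]
    · simp only [Pi.smul_apply, LinearMap.smul_apply, h3 V W h h', map_smul]

/-- Restriction of one-forms. -/
def resForm {U V : Opens M} (h : V ≤ U) {p : ℤ} (η : 𝓜.Form U p) : 𝓜.Form V p :=
  ⟨fun W => η.1 ⟨W.1, W.2.trans h⟩, fun W _ => η.2.1 W _, fun W _ => η.2.2.1 W _,
    fun W W' _ hW' => η.2.2.2 W W' _ hW'⟩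

/-- The left module structure on one-forms: `(f η)(X) = f * η(X)`. -/
def lmulForm {U : Opens M} {i p : ℤ} (f : 𝓜.gr U i) (η : 𝓜.Form U p) : 𝓜.Form U (i + p) :=
  ⟨fun V j => LinearMap.mulLeft ℝ (𝓜.res V.2 f.1) ∘ₗ η.1 V j, by
    obtain ⟨η, h1, h2, h3⟩ := η
    refine ⟨fun V h j X => ?_, fun V h a j g X => ?_, fun V W h h' j X => ?_⟩
    · have := SetLike.mul_mem_graded (𝓜.res_mem h i f.1 f.2) (h1 V h j X)
      rw [← add_assoc] at this
      exact this
    · simp only [LinearMap.comp_apply, LinearMap.mulLeft_apply, h2, mul_smul_comm, ← mul_assoc]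
      rw [𝓜.graded_comm V i a _ g.1 (𝓜.res_mem h i f.1 f.2) g.2]
      simp only [smul_mul_assoc, smul_smul, sign_mul, add_mul, add_comm]
    · simp [h3 V W h h', 𝓜.res_res]⟩

theorem lmulForm_apply {U : Opens M} (V : {V : Opens M // V ≤ U}) {i p j : ℤ} (f : 𝓜.gr U i)
    (η : 𝓜.Form U p) (X : 𝓜.VF V.1 j) :
    (lmulForm f η).1 V j X = 𝓜.res V.2 f.1 * η.1 V j X := rfl

/-- The right module structure on one-forms, as functions of bidegree `(p, 1)` on `T[1]𝓜`:
`η f = (-1)^{|f|(|η|+1)} f η`. -/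
def rmulForm {U : Opens M} {i p : ℤ} (η : 𝓜.Form U p) (f : 𝓜.gr U i) : 𝓜.Form U (i + p) :=
  (-1 : ℝ) ^ (i * (p + 1)) • lmulForm f η

/-- The differential `d x` of a homogeneous function, with the pairing
`⟨d x, X⟩ = (-1)^{|x|(|X|+1)} X(x)`. -/
def dForm {U : Opens M} {a : ℤ} (x : 𝓜.gr U a) : 𝓜.Form U a :=
  ⟨fun V j =>
    { toFun := fun X => (-1 : ℝ) ^ (a * (j + 1)) • X.1 ⟨V.1, le_rfl⟩ (𝓜.res V.2 x.1)
      map_add' := fun X Y => by simp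
      map_smul' := fun c X => by simp [smul_comm c] }, by
    refine ⟨fun V h j X => ?_, fun V h i j f X => ?_, fun V W h h' j X => ?_⟩
    · have := X.2.1 V le_rfl a _ (𝓜.res_mem h a x.1 x.2)
      rw [add_comm] at this
      exact Submodule.smul_mem _ _ this
    · simp only [LinearMap.coe_mk, AddHom.coe_mk, lmulVF, lmulOp, LinearMap.comp_apply,
        LinearMap.mulLeft_apply, 𝓜.res_self, mul_smul_comm, smul_smul, sign_mul]
      congr 2
      ring
    · simp only [LinearMap.coe_mk, AddHom.coe_mk, resVF, map_smul]
      rw [← X.2.2.2 V W le_rfl h', 𝓜.res_res]⟩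

theorem dForm_apply {U : Opens M} (V : {V : Opens M // V ≤ U}) {a j : ℤ} (x : 𝓜.gr U a) (X : 𝓜.VF V.1 j) :
    (dForm x).1 V j X =
      (-1 : ℝ) ^ (a * (j + 1)) • X.1 ⟨V.1, le_rfl⟩ (𝓜.res V.2 x.1) := rfl

/-- `d` is a derivation of degree `1` for the total degree on `T[1]𝓜`:
`d(x y) = (d x) y + (-1)^{|x|} x (d y)`. -/
theorem dForm_mul {U : Opens M} {a b : ℤ} (x : 𝓜.gr U a) (y : 𝓜.gr U b) :
    (dForm ⟨x.1 * y.1, SetLike.mul_mem_graded x.2 y.2⟩ : 𝓜.Form U (a + b)).1 =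
      (rmulForm (dForm x) y).1 + (-1 : ℝ) ^ a • (lmulForm x (dForm y)).1 := by
  ext V j X
  have hx := 𝓜.res_mem V.2 a x.1 x.2
  have hy := 𝓜.res_mem V.2 b y.1 y.2
  simp only [dForm_apply, rmulForm, lmulForm_apply, map_mul,
    X.2.2.1 V.1 le_rfl a _ _ hx, Submodule.coe_smul, Pi.add_apply, Pi.smul_apply,
    LinearMap.add_apply, LinearMap.smul_apply, mul_smul_comm, smul_smul,
    sign_mul, smul_add]
  rw [𝓜.graded_comm V.1 _ _ _ _ (X.2.1 V.1 le_rfl a _ hx) hy]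
  simp only [smul_smul, sign_mul]
  congr 2
  · exact sign_congr ⟨j * b, by ring⟩
  · exact sign_congr ⟨j * a, by ring⟩

theorem Form.apply_congr {U V : Opens M} (h : V ≤ U) {p j j' : ℤ} (η : 𝓜.Form U p)
    {X : 𝓜.VF V j} {X' : 𝓜.VF V j'} (hj : j = j') (hX : X.1 = X'.1) :
    η.1 ⟨V, h⟩ j X = η.1 ⟨V, h⟩ j' X' := by
  subst hj
  rw [Subtype.ext hX]

namespace HomologicalVF

variable (Q : 𝓜.HomologicalVF)

theorem lieVF_apply {U : Opens M} (V : {V : Opens M // V ≤ U}) {j : ℤ} (X : 𝓜.VF U j) (x : 𝓜.sec V.1) :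
    (Q.lieVF X).1 V x =
      Q.app V.1 (X.1 V x) - (-1 : ℝ) ^ j • X.1 V (Q.app V.1 x) := rfl

/-- The left Leibniz identity of the adjoint module. -/
theorem lieVF_lmulVF {U : Opens M} {i j : ℤ} (f : 𝓜.gr U i) (X : 𝓜.VF U j) :
    (Q.lieVF (lmulVF f X)).1 =
      (lmulVF ⟨Q.app U f.1, Q.app_mem f.2⟩ X).1 + (-1 : ℝ) ^ i • (lmulVF f (Q.lieVF X)).1 := by
  ext V x
  simp only [lieVF_apply, lmulVF_apply, LinearMap.smul_apply, Pi.add_apply,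
    Pi.smul_apply, LinearMap.add_apply, Q.app_mul (𝓜.res_mem V.2 i f.1 f.2), Q.app_res, mul_sub,
    smul_sub, mul_smul_comm, smul_smul, sign_mul]
  abel

/-- The right Leibniz identity of the adjoint module. -/
theorem lieVF_rmulVF {U : Opens M} {i j : ℤ} (X : 𝓜.VF U j) (f : 𝓜.gr U i) :
    (Q.lieVF (rmulVF X f)).1 =
      (rmulVF (Q.lieVF X) f).1 + (-1 : ℝ) ^ j • (rmulVF X ⟨Q.app U f.1, Q.app_mem f.2⟩).1 := by
  simp only [rmulVF, map_smul, Submodule.coe_smul, lieVF_lmulVF, smul_add, smul_smul, sign_mul]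
  rw [add_comm, sign_congr (i := i * j + i) (j := i * (j + 1)) ⟨0, by ring⟩,
    sign_congr (i := j + (1 + i) * j) (j := i * j) ⟨j, by ring⟩]

/-- The Lie derivative of one-forms, the differential of the dual of the adjoint module:
`Q(η(X)) = (ℒ_Q η)(X) + (-1)^{|η|} η(ℒ_Q X)`.  -/
def lieForm {U : Opens M} {p : ℤ} : 𝓜.Form U p →ₗ[ℝ] 𝓜.Form U (p + 1) where
  toFun η := ⟨fun V j => Q.app V.1 ∘ₗ η.1 V j - (-1 : ℝ) ^ p • (η.1 V (j + 1) ∘ₗ Q.lieVF), by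
    refine ⟨fun V h j X => ?_, fun V h i j f X => ?_, fun V W h h' j X => ?_⟩
    · refine sub_mem ?_ (Submodule.smul_mem _ _ ?_)
      · have := Q.app_mem (η.2.1 V h j X)
        rwa [show 1 + (p + j) = p + 1 + j by ring] at this
      · have := η.2.1 V h _ (Q.lieVF X)
        rwa [show p + (j + 1) = p + 1 + j by ring] at this
    · have e1 : 1 + i + j = i + j + 1 := by ring
      have e2 : i + (j + 1) = i + j + 1 := by ring
      have key : Q.lieVF (lmulVF f X) =
          ⟨(lmulVF ⟨Q.app V f.1, Q.app_mem f.2⟩ X).1, e1 ▸ (lmulVF _ X).2⟩ +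
          (-1 : ℝ) ^ i • (⟨(lmulVF f (Q.lieVF X)).1, e2 ▸ (lmulVF f _).2⟩ :
            𝓜.VF V (i + j + 1)) :=
        Subtype.ext (Q.lieVF_lmulVF f X)
      have a1 : η.1 ⟨V, h⟩ (i + j + 1) ⟨(lmulVF ⟨Q.app V f.1, Q.app_mem f.2⟩ X).1,
          e1 ▸ (lmulVF _ X).2⟩ = _ :=
        (Form.apply_congr h η e1.symm rfl).trans (η.2.2.1 V h (1 + i) j ⟨Q.app V f.1, Q.app_mem f.2⟩ X)
      have a2 : η.1 ⟨V, h⟩ (i + j + 1) ⟨(lmulVF f (Q.lieVF X)).1, e2 ▸ (lmulVF f _).2⟩ = _ :=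
        (Form.apply_congr h η e2.symm rfl).trans (η.2.2.1 V h i (j + 1) f (Q.lieVF X))
      simp only [LinearMap.sub_apply, LinearMap.comp_apply, LinearMap.smul_apply, key, map_add,
        map_smul, a1, a2, η.2.2.1, Q.app_mul f.2, smul_add, smul_sub, mul_sub, smul_smul, sign_mul,
        mul_smul_comm]
      rw [sign_congr (i := p + p * (1 + i)) (j := p * i) ⟨p, by ring⟩,
        sign_congr (i := p * i + i) (j := (p + 1) * i) ⟨0, by ring⟩,
        sign_congr (i := p + (i + p * i)) (j := (p + 1) * i + p) ⟨0, by ring⟩]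
      abel
    · have : Q.lieVF (resVF h' X) = resVF h' (Q.lieVF X) := rfl
      simp [η.2.2.2 V W h h', Q.app_res, this]⟩
  map_add' η θ := by
    ext V j X
    simp only [Submodule.coe_add, Pi.add_apply, LinearMap.sub_apply, LinearMap.comp_apply,
      LinearMap.smul_apply, LinearMap.add_apply, map_add, smul_add]
    abel
  map_smul' c η := by
    ext V j X
    simp [smul_sub, smul_comm c]

theorem lieForm_apply {U : Opens M} (V : {V : Opens M // V ≤ U}) {p j : ℤ} (η : 𝓜.Form U p) (X : 𝓜.VF V.1 j) :
    (Q.lieForm η).1 V j X =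
      Q.app V.1 (η.1 V j X) - (-1 : ℝ) ^ p • η.1 V (j + 1) (Q.lieVF X) := rfl

/-- The left Leibniz identity of the coadjoint module. -/
theorem lieForm_lmulForm {U : Opens M} {i p : ℤ} (f : 𝓜.gr U i) (η : 𝓜.Form U p) :
    (Q.lieForm (lmulForm f η)).1 =
      (lmulForm ⟨Q.app U f.1, Q.app_mem f.2⟩ η).1 + (-1 : ℝ) ^ i • (lmulForm f (Q.lieForm η)).1 := by
  ext V j X
  simp only [lieForm_apply, lmulForm_apply, LinearMap.smul_apply, Pi.add_apply,
    Pi.smul_apply, LinearMap.add_apply, Q.app_mul (𝓜.res_mem V.2 i f.1 f.2), Q.app_res, mul_sub,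
    smul_sub, mul_smul_comm, smul_smul, sign_mul]
  abel

/-- The right Leibniz identity of the coadjoint module with the differential `-ℒ_Q`. -/
theorem neg_lieForm_rmulForm {U : Opens M} {i p : ℤ} (η : 𝓜.Form U p) (f : 𝓜.gr U i) :
    (-Q.lieForm (rmulForm η f)).1 =
      (rmulForm (-Q.lieForm η) f).1 +
        (-1 : ℝ) ^ p • (rmulForm η ⟨Q.app U f.1, Q.app_mem f.2⟩).1 := by
  have e1 : (Q.lieForm (rmulForm η f)).1 =
      (-1 : ℝ) ^ (i * (p + 1)) • (Q.lieForm (lmulForm f η)).1 :=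
    congrArg Subtype.val (Q.lieForm.map_smul ((-1 : ℝ) ^ (i * (p + 1))) (lmulForm f η))
  have e2 : (rmulForm (-Q.lieForm η) f).1 =
      -((-1 : ℝ) ^ (i * (p + 1 + 1)) • (lmulForm f (Q.lieForm η)).1) := by
    ext V j X
    simp [rmulForm, lmulForm_apply]
  have e3 : (rmulForm η ⟨Q.app U f.1, Q.app_mem f.2⟩).1 =
      (-1 : ℝ) ^ ((1 + i) * (p + 1)) • (lmulForm ⟨Q.app U f.1, Q.app_mem f.2⟩ η).1 := rfl
  have e0 : (-Q.lieForm (rmulForm η f)).1 = -(Q.lieForm (rmulForm η f)).1 := rfl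
  refine (e0.trans (congrArg Neg.neg (e1.trans (congrArg _ (Q.lieForm_lmulForm f η))))).trans
    (Eq.trans ?_ (congrArg₂ (· + ·) e2.symm (congrArg ((-1 : ℝ) ^ p • ·) e3.symm)))
  generalize (lmulForm f (Q.lieForm η)).1 = A
  generalize (lmulForm ⟨Q.app U f.1, Q.app_mem f.2⟩ η).1 = C
  simp only [smul_add, smul_smul, sign_mul, neg_add]
  rw [sign_congr (i := i * (p + 1) + i) (j := i * (p + 1 + 1)) ⟨0, by ring⟩,
    sign_congr (i := p + (1 + i) * (p + 1)) (j := i * (p + 1) + 1) ⟨p, by ring⟩, ← neg_sign]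
  exact (add_comm _ _).trans (congrArg _ (neg_smul _ _).symm)

/-- On exact forms, `ℒ_Q (d x) = -d (Q x)`, as for `ℒ_Q = [i_Q, d]`. -/
theorem lieForm_dForm {U : Opens M} {a : ℤ} (x : 𝓜.gr U a) :
    (Q.lieForm (dForm x)).1 = -(dForm ⟨Q.app U x.1, Q.app_mem x.2⟩ : 𝓜.Form U (1 + a)).1 := by
  ext V j X
  simp only [lieForm_apply, dForm_apply, lieVF_apply, Pi.neg_apply, LinearMap.neg_apply,
    smul_sub, smul_smul, sign_mul, map_smul, Q.app_res, ← neg_smul, neg_sign]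
  rw [sign_congr (i := a + a * (j + 1 + 1)) (j := a * (j + 1)) ⟨a, by ring⟩,
    sign_congr (i := a + (a * (j + 1 + 1) + j)) (j := (1 + a) * (j + 1) + 1) ⟨a - 1, by ring⟩]
  abel

end HomologicalVF

/-! ### Poisson brackets -/

variable (𝓜) in
/-- A degree `k` Poisson bracket on `𝓜`. -/
structure PoissonBracket (k : ℤ) where
  br : ∀ U : Opens M, 𝓜.sec U →ₗ[ℝ] 𝓜.sec U →ₗ[ℝ] 𝓜.sec U
  br_res : ∀ {U V : Opens M} (h : V ≤ U) (x y : 𝓜.sec U),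
    br V (𝓜.res h x) (𝓜.res h y) = 𝓜.res h (br U x y)
  br_mem : ∀ (U : Opens M) (a b : ℤ) (x y : 𝓜.sec U), x ∈ 𝓜.gr U a → y ∈ 𝓜.gr U b →
    br U x y ∈ 𝓜.gr U (a + b + k)
  skew : ∀ (U : Opens M) (a b : ℤ) (x y : 𝓜.sec U), x ∈ 𝓜.gr U a → y ∈ 𝓜.gr U b →
    br U x y = -((-1 : ℝ) ^ ((a + k) * (b + k)) • br U y x)
  leibniz : ∀ (U : Opens M) (a b c : ℤ) (x y z : 𝓜.sec U),
    x ∈ 𝓜.gr U a → y ∈ 𝓜.gr U b → z ∈ 𝓜.gr U c →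
    br U x (y * z) = br U x y * z + (-1 : ℝ) ^ ((a + k) * b) • (y * br U x z)
  jacobi : ∀ (U : Opens M) (a b c : ℤ) (x y z : 𝓜.sec U),
    x ∈ 𝓜.gr U a → y ∈ 𝓜.gr U b → z ∈ 𝓜.gr U c →
    br U x (br U y z) =
      br U (br U x y) z + (-1 : ℝ) ^ ((a + k) * (b + k)) • br U y (br U x z)

namespace PoissonBracket

variable {k : ℤ} (B : 𝓜.PoissonBracket k)

/-- The Hamiltonian vector field `{x, ·}`, for a function `x` of any degree. -/
def hamOp (U : Opens M) : 𝓜.sec U →ₗ[ℝ] 𝓜.Op U where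
  toFun x := fun V => B.br V.1 (𝓜.res V.2 x)
  map_add' x y := by ext V z; simp
  map_smul' c x := by ext V z; simp

theorem leibniz_right {U : Opens M} {a b : ℤ} {x y : 𝓜.sec U} (hx : x ∈ 𝓜.gr U a)
    (hy : y ∈ 𝓜.gr U b) (z : 𝓜.sec U) :
    B.br U x (y * z) = B.br U x y * z + (-1 : ℝ) ^ ((a + k) * b) • (y * B.br U x z) := by
  induction z using DirectSum.Decomposition.inductionOn (𝓜.gr U) with
  | zero => simp
  | homogeneous z => exact B.leibniz U a b _ x y z hx hy z.2
  | add z w hz hw =>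
    simp only [mul_add, map_add, hz, hw, smul_add]
    abel

theorem hamOp_mem {U : Opens M} {a : ℤ} {x : 𝓜.sec U} (hx : x ∈ 𝓜.gr U a) :
    B.hamOp U x ∈ 𝓜.VF U (a + k) := by
  refine ⟨fun V h i y hy => ?_, fun V h i y z hy => ?_, fun V W h h' y => ?_⟩
  · have := B.br_mem V a i _ _ (𝓜.res_mem h a x hx) hy
    rwa [show a + i + k = a + k + i by ring] at this
  · exact B.leibniz_right (𝓜.res_mem h a x hx) hy z
  · simp [hamOp, ← B.br_res h', 𝓜.res_res]

/-- The Hamiltonian vector field of a homogeneous function. -/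
def ham (U : Opens M) (a : ℤ) : 𝓜.gr U a →ₗ[ℝ] 𝓜.VF U (a + k) :=
  ((B.hamOp U).domRestrict (𝓜.gr U a)).codRestrict _ fun x => B.hamOp_mem x.2

/-- Hamiltonian vector fields generate the sheaf of vector fields as a module over the structure
sheaf: locally, each vector field is a combination of Hamiltonian ones (non-homogeneous vector
fields being sums of homogeneous ones). -/
def IsSymplectic : Prop :=
  ∀ (U : Opens M) (j : ℤ) (X : 𝓜.VF U j), ∀ p ∈ U, ∃ (V : Opens M) (h : V ≤ U), p ∈ V ∧
    ∃ (N : ℕ) (f x : Fin N → 𝓜.sec V),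
      (resVF h X).1 = ∑ s, lmulOp (f s) (B.hamOp V (x s))

/-- Compatibility of a homological vector field and a Poisson bracket. -/
def Compatible (Q : 𝓜.HomologicalVF) : Prop :=
  ∀ (U : Opens M) (a : ℤ) (x y : 𝓜.sec U), x ∈ 𝓜.gr U a →
    Q.app U (B.br U x y) =
      B.br U (Q.app U x) y + (-1 : ℝ) ^ (a + k) • B.br U x (Q.app U y)

/-- The triple `(𝓜, Q, {·,·})` is symplectic: `Q` and the bracket are compatible and the bracket is
symplectic. -/
def IsSymplecticLie (Q : 𝓜.HomologicalVF) : Prop :=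
  B.Compatible Q ∧ B.IsSymplectic

theorem ham_res {U V : Opens M} (h : V ≤ U) {a : ℤ} (x : 𝓜.gr U a) :
    B.ham V a ⟨𝓜.res h x.1, 𝓜.res_mem h a _ x.2⟩ = resVF h (B.ham U a x) := by
  ext ⟨W, hW⟩ y
  simp [ham, hamOp, resVF, 𝓜.res_res]

/-- `{x y, ·} = x {y, ·} + (-1)^{|x||y|} y {x, ·}`. -/
theorem ham_mul {U : Opens M} {a b : ℤ} (x : 𝓜.gr U a) (y : 𝓜.gr U b) :
    (B.ham U (a + b) ⟨x.1 * y.1, SetLike.mul_mem_graded x.2 y.2⟩).1 =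
      (lmulVF x (B.ham U b y)).1 + (-1 : ℝ) ^ (a * b) • (lmulVF y (B.ham U a x)).1 := by
  ext V z
  have hx := 𝓜.res_mem V.2 a x.1 x.2
  have hy := 𝓜.res_mem V.2 b y.1 y.2
  simp only [ham, hamOp, lmulVF, lmulOp, LinearMap.codRestrict_apply, LinearMap.domRestrict_apply,
    LinearMap.coe_mk, AddHom.coe_mk, map_mul, Pi.add_apply, Pi.smul_apply, LinearMap.add_apply,
    LinearMap.smul_apply, LinearMap.comp_apply, LinearMap.mulLeft_apply]
  generalize 𝓜.res V.2 x.1 = x at *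
  generalize 𝓜.res V.2 y.1 = y at *
  induction z using DirectSum.Decomposition.inductionOn (𝓜.gr V.1) with
  | zero => simp
  | add z w hz hw =>
    simp only [mul_add, map_add, hz, hw, smul_add]
    abel
  | @homogeneous c z =>
    rw [B.skew V.1 _ c _ _ (SetLike.mul_mem_graded hx hy) z.2, B.leibniz V.1 c a b _ _ _ z.2 hx hy,
      B.skew V.1 a c _ _ hx z.2, B.skew V.1 b c _ _ hy z.2]
    rw [𝓜.graded_comm V.1 _ _ _ _ (B.br_mem V.1 c a _ _ z.2 hx) hy]
    simp only [smul_add, smul_neg, mul_neg, mul_smul_comm, smul_smul, sign_mul, neg_add]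
    refine (add_comm _ _).trans ?_
    congr 3
    · exact sign_congr ⟨a * (c + k), by ring⟩
    · exact sign_congr ⟨b * (c + k), by ring⟩

/-- The operator `♯ η`, on functions of degree `b`. -/
def sharpAux {U : Opens M} {p : ℤ} (η : 𝓜.Form U p) (V : {V : Opens M // V ≤ U}) (b : ℤ) :
    𝓜.gr V.1 b →ₗ[ℝ] 𝓜.sec V.1 :=
  -((-1 : ℝ) ^ (p + k * (b + k)) • (η.1 V (b + k) ∘ₗ B.ham V.1 b))

/-- The operator `♯ η` on functions. -/
def sharpOp {U : Opens M} {p : ℤ} (η : 𝓜.Form U p) : 𝓜.Op U := fun V =>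
  DirectSum.toModule ℝ ℤ _ (B.sharpAux η V) ∘ₗ
    (DirectSum.decomposeLinearEquiv (𝓜.gr V.1)).toLinearMap

theorem sharpOp_apply {U V : Opens M} (h : V ≤ U) {p b : ℤ} (η : 𝓜.Form U p) {x : 𝓜.sec V}
    (hx : x ∈ 𝓜.gr V b) : B.sharpOp η ⟨V, h⟩ x =
      -((-1 : ℝ) ^ (p + k * (b + k)) • η.1 ⟨V, h⟩ (b + k) (B.ham V b ⟨x, hx⟩)) := by
  have : DirectSum.decompose (𝓜.gr V) x = DirectSum.lof ℝ ℤ (fun i => 𝓜.gr V i) b ⟨x, hx⟩ :=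
    DirectSum.decompose_of_mem _ hx
  simp only [sharpOp, LinearMap.comp_apply, LinearEquiv.coe_coe,
    DirectSum.decomposeLinearEquiv_apply, this, DirectSum.toModule_lof]
  rfl

theorem sharpOp_mem {U : Opens M} {p : ℤ} (η : 𝓜.Form U p) :
    B.sharpOp η ∈ 𝓜.VF U (p + k) := by
  refine ⟨fun V h i x hx => ?_, fun V h i x y hx => ?_, fun V W h h' x => ?_⟩
  · rw [B.sharpOp_apply h η hx]
    have := η.2.1 V h _ (B.ham V i ⟨x, hx⟩)
    rw [show p + (i + k) = p + k + i by ring] at this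
    exact neg_mem (Submodule.smul_mem _ _ this)
  · induction y using DirectSum.Decomposition.inductionOn (𝓜.gr V) with
    | zero => simp
    | add z w hz hw =>
      simp only [mul_add, map_add, hz, hw, smul_add]
      abel
    | @homogeneous c y =>
      obtain ⟨y, hy⟩ := y
      have e1 : i + (c + k) = i + c + k := by ring
      have e2 : c + (i + k) = i + c + k := by ring
      have key : B.ham V (i + c) ⟨x * y, SetLike.mul_mem_graded hx hy⟩ =
          ⟨(lmulVF ⟨x, hx⟩ (B.ham V c ⟨y, hy⟩)).1, e1 ▸ (lmulVF _ (B.ham V c ⟨y, hy⟩)).2⟩ +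
          (-1 : ℝ) ^ (i * c) • (⟨(lmulVF ⟨y, hy⟩ (B.ham V i ⟨x, hx⟩)).1,
            e2 ▸ (lmulVF _ (B.ham V i ⟨x, hx⟩)).2⟩ : 𝓜.VF V (i + c + k)) :=
        Subtype.ext (B.ham_mul ⟨x, hx⟩ ⟨y, hy⟩)
      have a1 : η.1 ⟨V, h⟩ (i + c + k) ⟨(lmulVF ⟨x, hx⟩ (B.ham V c ⟨y, hy⟩)).1,
          e1 ▸ (lmulVF _ (B.ham V c ⟨y, hy⟩)).2⟩ = _ :=
        (Form.apply_congr h η e1.symm rfl).trans (η.2.2.1 V h i (c + k) ⟨x, hx⟩ _)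
      have a2 : η.1 ⟨V, h⟩ (i + c + k) ⟨(lmulVF ⟨y, hy⟩ (B.ham V i ⟨x, hx⟩)).1,
          e2 ▸ (lmulVF _ (B.ham V i ⟨x, hx⟩)).2⟩ = _ :=
        (Form.apply_congr h η e2.symm rfl).trans (η.2.2.1 V h c (i + k) ⟨y, hy⟩ _)
      rw [B.sharpOp_apply h η (SetLike.mul_mem_graded hx hy), B.sharpOp_apply h η hx,
        B.sharpOp_apply h η hy, key, map_add, map_smul, a1, a2,
        𝓜.graded_comm V _ _ _ _ hy (η.2.1 V h _ (B.ham V i ⟨x, hx⟩))]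
      simp only [smul_add, smul_neg, mul_neg, neg_mul, mul_smul_comm, smul_mul_assoc, smul_smul,
        sign_mul, neg_add]
      refine (add_comm _ _).trans ?_
      congr 3
      · exact sign_congr ⟨c * (p + i + k), by ring⟩
      · exact sign_congr ⟨0, by ring⟩
  · induction x using DirectSum.Decomposition.inductionOn (𝓜.gr V) with
    | zero => simp
    | add z w hz hw => simp only [map_add, hz, hw]
    | @homogeneous c x =>
      rw [B.sharpOp_apply (h'.trans h) η (𝓜.res_mem h' c x.1 x.2), B.sharpOp_apply h η x.2,
        B.ham_res h' x, η.2.2.2 V W h h']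
      simp

/-- The map `♯ : Ω¹ → 𝔛` of degree `k` induced by a Poisson bracket. On exact forms it is
`(♯(d x)) y = {x, y}` (`sharp_dForm`), and it satisfies `♯(f η) = (-1)^{|f|} f ♯(η)`
(`sharp_lmulForm`). -/
def sharp (U : Opens M) (p : ℤ) (η : 𝓜.Form U p) : 𝓜.VF U (p + k) :=
  ⟨B.sharpOp η, B.sharpOp_mem η⟩

theorem sharp_dForm {U : Opens M} {a : ℤ} (x : 𝓜.gr U a) :
    B.sharp U a (dForm x) = B.ham U a x := by
  ext V y
  induction y using DirectSum.Decomposition.inductionOn (𝓜.gr V.1) with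
  | zero => simp
  | add z w hz hw => simp only [map_add, hz, hw]
  | @homogeneous c y =>
    refine (B.sharpOp_apply V.2 (dForm x) y.2).trans ?_
    have hx := 𝓜.res_mem V.2 a x.1 x.2
    rw [dForm_apply V x]
    simp only [ham, hamOp, LinearMap.codRestrict_apply, LinearMap.domRestrict_apply,
      LinearMap.coe_mk, AddHom.coe_mk, 𝓜.res_self]
    rw [B.skew V.1 a c _ _ hx y.2, smul_smul, sign_mul]
    congr 2
    exact sign_congr ⟨a + k * c + k * k - k * a - k * k + k * a - k * c, by ring⟩

theorem sharp_lmulForm {U : Opens M} {i p : ℤ} (f : 𝓜.gr U i) (η : 𝓜.Form U p) :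
    (B.sharp U (i + p) (lmulForm f η)).1 = (-1 : ℝ) ^ i • (lmulVF f (B.sharp U p η)).1 := by
  ext V y
  induction y using DirectSum.Decomposition.inductionOn (𝓜.gr V.1) with
  | zero => simp
  | add z w hz hw => simp only [map_add, hz, hw]
  | @homogeneous c y =>
    have e : (B.sharp U p η).1 V y.1 = _ := B.sharpOp_apply V.2 η y.2
    refine (B.sharpOp_apply V.2 (lmulForm f η) y.2).trans ?_
    simp only [lmulForm_apply, Pi.smul_apply, LinearMap.smul_apply, lmulVF_apply, e, mul_neg,
      mul_smul_comm, smul_neg, smul_smul, sign_mul]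
    congr 2
    exact sign_congr ⟨0, by ring⟩

end PoissonBracket

/-! ### Isomorphisms of differential graded modules -/

/-- An anti-isomorphism of degree `k` of left DG modules from `(Ω¹, ℒ_Q)` to `(𝔛, ℒ_Q)`:
an isomorphism of sheaves in each degree, odd linear and anticommuting with the differentials. -/
structure IsLeftDGAntiIso (Q : 𝓜.HomologicalVF) {k : ℤ}
    (μ : ∀ (U : Opens M) (p : ℤ), 𝓜.Form U p → 𝓜.VF U (p + k)) : Prop where
  map_add : ∀ (U : Opens M) (p : ℤ) (η θ : 𝓜.Form U p), μ U p (η + θ) = μ U p η + μ U p θ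
  map_res : ∀ {U V : Opens M} (h : V ≤ U) (p : ℤ) (η : 𝓜.Form U p),
    μ V p (resForm h η) = resVF h (μ U p η)
  map_lmul : ∀ (U : Opens M) (i p : ℤ) (f : 𝓜.gr U i) (η : 𝓜.Form U p),
    (μ U (i + p) (lmulForm f η)).1 = (-1 : ℝ) ^ i • (lmulVF f (μ U p η)).1
  map_differential : ∀ (U : Opens M) (p : ℤ) (η : 𝓜.Form U p),
    (μ U (p + 1) (Q.lieForm η)).1 = -(Q.lieVF (μ U p η)).1
  bijective : ∀ (U : Opens M) (p : ℤ), Function.Bijective (μ U p)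

/-- The right module structure on the shift `𝔛[k] = 𝔛 ⊗ ℝ[k]`: `(X ⊗ 1) f = (-1)^{k|f|} X f ⊗ 1`. -/
def rmulShiftVF (k : ℤ) {U : Opens M} {i j : ℤ} (X : 𝓜.VF U j) (f : 𝓜.gr U i) : 𝓜.VF U (i + j) :=
  (-1 : ℝ) ^ (k * i) • rmulVF X f

/-- An isomorphism of degree `k` of right DG modules from `(Ω¹, -ℒ_Q)` to `(𝔛, ℒ_Q)`, that is, an
isomorphism of right DG modules from `(Ω¹, -ℒ_Q)` to the shift `(𝔛[k], ℒ_Q)`. -/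
structure IsRightDGIso (Q : 𝓜.HomologicalVF) {k : ℤ}
    (μ : ∀ (U : Opens M) (p : ℤ), 𝓜.Form U p → 𝓜.VF U (p + k)) : Prop where
  map_add : ∀ (U : Opens M) (p : ℤ) (η θ : 𝓜.Form U p), μ U p (η + θ) = μ U p η + μ U p θ
  map_res : ∀ {U V : Opens M} (h : V ≤ U) (p : ℤ) (η : 𝓜.Form U p),
    μ V p (resForm h η) = resVF h (μ U p η)
  map_rmul : ∀ (U : Opens M) (i p : ℤ) (f : 𝓜.gr U i) (η : 𝓜.Form U p),
    (μ U (i + p) (rmulForm η f)).1 = (rmulShiftVF k (μ U p η) f).1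
  map_differential : ∀ (U : Opens M) (p : ℤ) (η : 𝓜.Form U p),
    (μ U (p + 1) (-Q.lieForm η)).1 = (Q.lieVF (μ U p η)).1
  bijective : ∀ (U : Opens M) (p : ℤ), Function.Bijective (μ U p)

end NManifold
end

/-!
The anti-linearity of `♯` holds for every bracket, and the two sign conventions for left and right
modules are exchanged by an invertible sign, so both notions of isomorphism say the same: `♯`
anticommutes with the differentials and is bijective on sections in each degree. These two
properties are treated separately.

*Differentials.* The value of `♯ η` on a function `y` is `± η({y, ·})`, and `♯ (d x) = {x, ·}`.
Compatibility says that `{Q x, ·} = [Q, {x, ·}]` (`compatible_iff_lieVF_ham`). Inserted into the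
definition of the Lie derivative of one-forms this gives `♯ ∘ ℒ_Q = -ℒ_Q ∘ ♯`, and the converse
results from evaluating the latter on exact forms (`compatible_iff_sharp_lieForm`).

*Symplectic brackets induce bijections.* If vector fields are locally combinations of Hamiltonian
ones, they are so with homogeneous coefficients of the right degree, by taking homogeneous
components (`IsSymplectic.exists_mem_span`). If `♯ η = 0`, then `η` kills Hamiltonian vector
fields and hence all vector fields (`sharp_injective`). A combination `∑ f {x, ·}` is the image of
`∑ ± f d x`, so `♯` is locally surjective; by injectivity the local preimages agree on overlaps and
glue (`sharp_surjective`). No coordinates are needed for this direction.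

*Bijections come from symplectic brackets.* It suffices that one-forms are locally generated by
exact ones: if `X = ♯ η` and `η = ∑ f d z`, then `X = ∑ ± f {z, ·}` (`sharp_eq_sum`). One-forms are
defined as the dual of vector fields, so the point is that locally vector fields are free on the
partial derivatives by coordinates `z` (`exists_coordinates`). The partial derivatives exist because
locally the functions form a free graded commutative algebra over the smooth functions, on which the
Koszul sign rule defines derivations by the generators (`GradedFree.IsFree.exists_partial`) and to
which the derivations of smooth functions extend
(`GradedFree.IsFree.exists_base_derivation`). They span because a vector field is determined by its
values on coordinates (`VF.eq_zero`); for the smooth functions this is Hadamard's lemma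
(`SmoothCoord.exists_restrict_eq`).
-/

/-! ### Free graded commutative algebras -/

namespace GradedFree

variable {A : Type*} [Ring A] [Algebra ℝ A] (gr : ℤ → Submodule ℝ A)

/-- Graded commutativity of an algebra with respect to a family of homogeneous components:
`x * y = (-1) ^ (|x| * |y|) * (y * x)`. -/
def GradedComm : Prop :=
  ∀ (i j : ℤ) (x y : A), x ∈ gr i → y ∈ gr j → x * y = (-1 : ℝ) ^ (i * j) • (y * x)

variable {gr}

theorem GradedComm.sq_eq_zero (hc : GradedComm gr) {i : ℤ} (hi : Odd i) {x : A}
    (hx : x ∈ gr i) : x * x = 0 := by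
  have h := hc i i x x hx hx
  rw [(hi.mul hi).neg_one_zpow, neg_one_smul] at h
  have h2 : (2 : ℝ) • (x * x) = 0 := by
    rw [two_smul]
    nth_rewrite 1 [h]
    simp
  exact (smul_eq_zero.mp h2).resolve_left two_ne_zero

/-- Koszul sign rule: multiplying an ordered product from the left by `x` multiplies its `b`-th
factor by `x`, up to the sign of moving `x` past the factors before it. -/
theorem GradedComm.mul_prod_ofFn (hc : GradedComm gr) {N : ℕ} (F : Fin N → A) (d : Fin N → ℤ)
    (hF : ∀ a, F a ∈ gr (d a)) {e : ℤ} {x : A} (hx : x ∈ gr e) (b : Fin N) :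
    x * (List.ofFn F).prod = (-1 : ℝ) ^ (e * ∑ a, if a < b then d a else 0) •
      (List.ofFn (Function.update F b (x * F b))).prod := by
  induction N with
  | zero => exact b.elim0
  | succ N ih =>
    refine Fin.cases ?_ (fun b => ?_) b
    · simp [List.ofFn_succ, mul_assoc]
    · have := ih (fun a => F a.succ) (fun a => d a.succ) (fun a => hF _) b
      have hu : (fun a : Fin N => Function.update F b.succ (x * F b.succ) a.succ) =
          Function.update (fun a => F a.succ) b (x * F b.succ) := by
        ext a
        by_cases h : a = b
        · subst h; simp
        · simp [h]
      rw [List.ofFn_succ, List.prod_cons, ← mul_assoc, hc e (d 0) x (F 0) hx (hF 0),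
        smul_mul_assoc, mul_assoc, this, List.ofFn_succ, List.prod_cons, hu,
        Function.update_of_ne (Fin.succ_ne_zero b).symm, Fin.sum_univ_succ]
      simp only [Fin.succ_lt_succ_iff, Fin.succ_pos, if_true, mul_smul_comm, smul_smul,
        NManifold.sign_mul, mul_add]

/-- The ordered monomial `ξ₀ ^ β₀ * ξ₁ ^ β₁ * ⋯`. -/
def mono {A : Type*} [Ring A] {N : ℕ} (ξ : Fin N → A) (β : Fin N → ℕ) : A :=
  (List.ofFn fun a => ξ a ^ β a).prod

/-- The total degree of the factors that precede the `b`-th one in a monomial with exponents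
`β`. -/
def lowerDegree {N : ℕ} (d : Fin N → ℤ) (β : Fin N → ℕ) (b : Fin N) : ℤ :=
  ∑ a, if a < b then d a * β a else 0

/-- The degree of the monomial with exponents `β`. -/
def weight {N : ℕ} (d : Fin N → ℤ) (β : Fin N → ℕ) : ℤ := ∑ a, d a * β a

/-- The coefficient `1 + s + ⋯ + s ^ (k - 1)`, `s = (-1) ^ e`, of `ξ ^ (k - 1)` in the derivative
of `ξ ^ k` for `ξ` of degree `e`. It is `k` for even `e`; for odd `e` it is the parity of `k`. -/
noncomputable def derivCoeff (e : ℤ) (k : ℕ) : ℝ := ∑ l ∈ Finset.range k, ((-1 : ℝ) ^ e) ^ l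

section Monomials

variable [GradedAlgebra gr] {N : ℕ} {d : Fin N → ℤ} {ξ : Fin N → A}

omit [Algebra ℝ A] [GradedAlgebra gr] in
@[simp] theorem mono_zero : mono ξ 0 = 1 := by simp [mono]

theorem mono_mem (hξ : ∀ a, ξ a ∈ gr (d a)) (β : Fin N → ℕ) : mono ξ β ∈ gr (weight d β) := by
  have := SetLike.list_prod_ofFn_mem_graded (A := gr) (fun a => β a • d a) (fun a => ξ a ^ β a)
    fun a => SetLike.pow_mem_graded _ (hξ a)
  simpa [mono, weight, List.sum_ofFn, mul_comm] using this

/-- Multiplication of a monomial by a variable raises the exponent of that variable. The formula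
also holds when the result vanishes because a variable of odd degree occurs twice. -/
theorem mul_mono (hc : GradedComm gr) (hξ : ∀ a, ξ a ∈ gr (d a)) (b : Fin N) (β : Fin N → ℕ) :
    ξ b * mono ξ β = (-1 : ℝ) ^ (d b * lowerDegree d β b) • mono ξ (β + Pi.single b 1) := by
  have h := hc.mul_prod_ofFn (fun a => ξ a ^ β a) (fun a => β a • d a)
    (fun a => SetLike.pow_mem_graded _ (hξ a)) (hξ b) b
  have hu : Function.update (fun a => ξ a ^ β a) b (ξ b * ξ b ^ β b) =
      fun a => ξ a ^ (β + (Pi.single b 1 : Fin N → ℕ)) a := by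
    ext a
    by_cases h : a = b
    · subst h; simp [pow_succ']
    · simp [h]
  rw [hu] at h
  simpa [mono, lowerDegree, mul_comm] using h

omit [GradedAlgebra gr] in
theorem mono_eq_zero (hc : GradedComm gr) (hξ : ∀ a, ξ a ∈ gr (d a)) {β : Fin N → ℕ} {a : Fin N}
    (ha : Odd (d a)) (h2 : 2 ≤ β a) : mono ξ β = 0 := by
  refine List.prod_eq_zero ?_
  rw [List.mem_ofFn]
  refine ⟨a, ?_⟩
  obtain ⟨k, hk⟩ := Nat.exists_eq_add_of_le h2
  simp [hk, pow_add, pow_two, hc.sq_eq_zero ha (hξ a)]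

theorem lowerDegree_add_single (β : Fin N → ℕ) (a b : Fin N) :
    lowerDegree d (β + Pi.single a 1) b = lowerDegree d β b + if a < b then d a else 0 := by
  have : ∀ c, (if c < b then d c * ((β + (Pi.single a 1 : Fin N → ℕ)) c : ℕ) else 0 : ℤ) =
      (if c < b then d c * β c else 0) + if c = a then (if a < b then d a else 0) else 0 := by
    intro c
    by_cases h : c = a
    · subst h; by_cases h' : c < b <;> simp [h', mul_add]
    · simp [h]
  simp only [lowerDegree, this, Finset.sum_add_distrib, Finset.sum_ite_eq', Finset.mem_univ,
    if_true]

theorem weight_add_single (β : Fin N → ℕ) (a : Fin N) :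
    weight d (β + Pi.single a 1) = weight d β + d a := by
  have : ∀ c, d c * ((β + (Pi.single a 1 : Fin N → ℕ)) c : ℕ) = d c * β c + if c = a then d a else 0 := by
    intro c
    by_cases h : c = a
    · subst h; simp [mul_add]
    · simp [h]
  simp only [weight, this, Finset.sum_add_distrib, Finset.sum_ite_eq', Finset.mem_univ, if_true]

theorem derivCoeff_zero (e : ℤ) : derivCoeff e 0 = 0 := by simp [derivCoeff]

theorem derivCoeff_succ (e : ℤ) (k : ℕ) :
    derivCoeff e (k + 1) = 1 + (-1 : ℝ) ^ e * derivCoeff e k := by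
  simp [derivCoeff, Finset.sum_range_succ', Finset.mul_sum, pow_succ', add_comm]

/-- The derivative of a monomial by the `a`-th variable, an operator of degree `-d a`: the sign is
that of moving the operator past the factors before the `a`-th one. The truncated subtraction in
the exponent does no harm, as the coefficient vanishes for `β a = 0`. -/
noncomputable def monoDeriv (d : Fin N → ℤ) (ξ : Fin N → A) (a : Fin N) (β : Fin N → ℕ) : A :=
  (derivCoeff (d a) (β a) * (-1 : ℝ) ^ (d a * lowerDegree d β a)) • mono ξ (β - Pi.single a 1)

theorem monoDeriv_add_single (a : Fin N) (β : Fin N → ℕ) :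
    monoDeriv d ξ a (β + Pi.single a 1) =
      (derivCoeff (d a) (β a + 1) * (-1 : ℝ) ^ (d a * lowerDegree d β a)) • mono ξ β := by
  simp [monoDeriv, lowerDegree_add_single, add_tsub_cancel_right]

theorem monoDeriv_of_eq_zero {a : Fin N} {β : Fin N → ℕ} (h : β a = 0) :
    monoDeriv d ξ a β = 0 := by
  simp [monoDeriv, h, derivCoeff_zero]

/-- Exponents with a positive `a`-th entry are obtained by raising that entry, which avoids
truncated subtraction in computations. -/
theorem exists_add_single {a : Fin N} {β : Fin N → ℕ} (h : β a ≠ 0) :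
    ∃ γ : Fin N → ℕ, β = γ + Pi.single a 1 := by
  refine ⟨β - Pi.single a 1, (tsub_add_cancel_of_le fun c => ?_).symm⟩
  by_cases hc : c = a
  · subst hc; simpa using Nat.one_le_iff_ne_zero.mpr h
  · simp [hc]

theorem monoDeriv_mem (hξ : ∀ a, ξ a ∈ gr (d a)) (a : Fin N) (β : Fin N → ℕ) :
    monoDeriv d ξ a β ∈ gr (-d a + weight d β) := by
  by_cases h : β a = 0
  · simp [monoDeriv_of_eq_zero h]
  · obtain ⟨γ, rfl⟩ := exists_add_single h
    rw [monoDeriv_add_single, weight_add_single, show -d a + (weight d γ + d a) = weight d γ by ring]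
    exact Submodule.smul_mem _ _ (mono_mem hξ γ)

omit [GradedAlgebra gr] in
/-- The derivative of an unreduced monomial vanishes, as the monomial itself does. -/
theorem monoDeriv_eq_zero (hc : GradedComm gr) (hξ : ∀ a, ξ a ∈ gr (d a)) (a : Fin N)
    {β : Fin N → ℕ} {b : Fin N} (hb : Odd (d b)) (h2 : 2 ≤ β b) : monoDeriv d ξ a β = 0 := by
  by_cases h : β a = 0
  · exact monoDeriv_of_eq_zero h
  obtain ⟨γ, rfl⟩ := exists_add_single h
  rw [monoDeriv_add_single]
  -- Either the lowered monomial is still unreduced, or the exponent of the variable drops from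
  -- `2` to `1` and the coefficient `1 + (-1)` vanishes.
  by_cases hγ : 2 ≤ γ b
  · rw [mono_eq_zero hc hξ hb hγ, smul_zero]
  · have hab : b = a := by
      by_contra hab
      simp [hab] at h2
      omega
    subst hab
    have : γ b = 1 := by simp at h2; omega
    simp [this, derivCoeff, Finset.sum_range_succ, hb.neg_one_zpow]

/-- The Leibniz rule of a partial derivative for the product of a variable and a monomial. -/
theorem monoDeriv_mul (hc : GradedComm gr) (hξ : ∀ a, ξ a ∈ gr (d a)) (a b : Fin N)
    (β : Fin N → ℕ) :
    (-1 : ℝ) ^ (d b * lowerDegree d β b) • monoDeriv d ξ a (β + Pi.single b 1) =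
      (if a = b then mono ξ β else 0) + (-1 : ℝ) ^ (-d a * d b) • (ξ b * monoDeriv d ξ a β) := by
  by_cases hab : a = b
  · subst hab
    rw [monoDeriv_add_single, if_pos rfl]
    by_cases h : β a = 0
    · rw [monoDeriv_of_eq_zero h, h, derivCoeff_succ, derivCoeff_zero]
      simp only [mul_zero, add_zero, one_mul, smul_smul, smul_zero, NManifold.sign_mul]
      rw [Even.neg_one_zpow ⟨_, rfl⟩, one_smul]
    · obtain ⟨γ, rfl⟩ := exists_add_single h
      rw [monoDeriv_add_single, mul_smul_comm, mul_mono hc hξ, derivCoeff_succ]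
      simp only [lowerDegree_add_single, lt_irrefl, if_false, add_zero, smul_smul, Pi.add_apply,
        Pi.single_eq_same]
      have h1 : (-1 : ℝ) ^ (d a * lowerDegree d γ a) * (-1 : ℝ) ^ (d a * lowerDegree d γ a) = 1 := by
        rw [NManifold.sign_mul, Even.neg_one_zpow ⟨_, rfl⟩]
      have h2 : (-1 : ℝ) ^ (-d a * d a) = (-1 : ℝ) ^ d a := by
        refine NManifold.sign_congr ?_
        have := Int.even_mul_succ_self (d a)
        rw [show -d a * d a - d a = -(d a * (d a + 1)) by ring]
        exact this.neg
      rw [h2]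
      generalize (-1 : ℝ) ^ (d a * lowerDegree d γ a) = s at *
      rw [show ∀ c : ℝ, s * ((1 + c) * s) = 1 + c from fun c => by
          rw [mul_left_comm, h1, mul_one],
        show (-1 : ℝ) ^ d a * (derivCoeff (d a) (γ a + 1) * s * s) =
          (-1 : ℝ) ^ d a * derivCoeff (d a) (γ a + 1) by rw [mul_assoc _ s, h1, mul_one],
        add_smul, one_smul]
  · rw [if_neg hab, zero_add]
    by_cases h : β a = 0
    · rw [monoDeriv_of_eq_zero h, monoDeriv_of_eq_zero (by simp [h, hab]), smul_zero, mul_zero,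
        smul_zero]
    · obtain ⟨γ, rfl⟩ := exists_add_single h
      rw [add_right_comm, monoDeriv_add_single, monoDeriv_add_single, mul_smul_comm,
        mul_mono hc hξ, smul_smul, smul_smul, smul_smul]
      congr 1
      simp only [lowerDegree_add_single, Pi.add_apply, Pi.single_eq_of_ne hab, add_zero]
      generalize derivCoeff (d a) (γ a + 1) = c
      generalize lowerDegree d γ a = p
      generalize lowerDegree d γ b = q
      rw [mul_left_comm, NManifold.sign_mul, mul_left_comm ((-1 : ℝ) ^ (-d a * d b)) c,
        mul_assoc c, NManifold.sign_mul, NManifold.sign_mul]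
      congr 1
      refine NManifold.sign_congr ?_
      rcases lt_or_gt_of_ne hab with h' | h'
      · rw [if_pos h', if_neg h'.not_gt]
        exact ⟨d a * d b, by ring⟩
      · rw [if_neg h'.not_gt, if_pos h']
        exact ⟨d a * d b, by ring⟩

end Monomials

/-! ### Derivations of free graded commutative algebras -/

section Derivations

variable [GradedAlgebra gr] {C : Type*} [CommRing C] [Algebra ℝ C] {N : ℕ} {ι : Type*}

/-- The algebra `A` is the free graded commutative algebra over `s : C → A` on generators `ξ a`
of degree `d a`: the ordered monomials form a basis. The basis is indexed by a type `ι` with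
exponents `ex : ι → Fin N → ℕ`, among which are all exponents that do not repeat a generator of
odd degree. -/
structure IsFree (gr : ℤ → Submodule ℝ A) (s : C →ₐ[ℝ] A) (d : Fin N → ℤ)
    (ξ : Fin N → A) (ex : ι → Fin N → ℕ) : Prop where
  comm : GradedComm gr
  base_mem : ∀ f, s f ∈ gr 0
  gen_mem : ∀ a, ξ a ∈ gr (d a)
  exists_index : ∀ β : Fin N → ℕ, (∀ a, Odd (d a) → β a ≤ 1) → ∃ α, ex α = β
  bijective : Function.Bijective
    fun c : ι →₀ C => c.sum fun α f => s f * mono ξ (ex α)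

namespace IsFree

variable {s : C →ₐ[ℝ] A} {d : Fin N → ℤ} {ξ : Fin N → A} {ex : ι → Fin N → ℕ}
  (F : IsFree gr s d ξ ex)

include F

theorem base_comm (f : C) (x : A) : s f * x = x * s f := by
  induction x using DirectSum.Decomposition.inductionOn gr with
  | zero => simp
  | homogeneous x => simpa using F.comm 0 _ _ _ (F.base_mem f) x.2
  | add x y hx hy => rw [mul_add, hx, hy, add_mul]

omit [GradedAlgebra gr] in
/-- Induction over combinations of monomials. Unreduced monomials are included among the cases,
which costs nothing and avoids a case distinction in the applications. -/
theorem induction_on {p : A → Prop} (x : A) (add : ∀ x y, p x → p y → p (x + y))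
    (basis : ∀ f β, p (s f * mono ξ β)) : p x := by
  obtain ⟨c, rfl⟩ := F.bijective.2 x
  induction c using Finsupp.induction_linear with
  | zero => simpa using basis 0 0
  | add c e hc he =>
    have := add _ _ hc he
    rwa [← Finsupp.sum_add_index' (by simp) (by simp [add_mul])] at this
  | single α f => simpa using basis f (ex α)

/-- A homogeneous element is a combination of monomials of its degree. -/
theorem homogeneous_induction_on {i : ℤ} {p : A → Prop} (x : A) (hx : x ∈ gr i) (zero : p 0)
    (add : ∀ x y, p x → p y → p (x + y))
    (basis : ∀ f β, weight d β = i → p (s f * mono ξ β)) : p x := by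
  -- Take homogeneous components of an arbitrary combination of monomials.
  have key : ∀ x, p (DirectSum.decompose gr x i : A) := by
    intro x
    refine F.induction_on (p := fun x => p (DirectSum.decompose gr x i : A)) x
      (fun x y h h' => ?_) fun f β => ?_
    · rw [DirectSum.decompose_add]
      exact add _ _ h h'
    · have hm : s f * mono ξ β ∈ gr (weight d β) := by
        simpa using SetLike.mul_mem_graded (F.base_mem f) (mono_mem F.gen_mem β)
      by_cases h : weight d β = i
      · subst h
        rw [DirectSum.decompose_of_mem_same gr hm]
        exact basis f β rfl
      · rw [DirectSum.decompose_of_mem_ne gr hm h]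
        exact zero
  have := key x
  rwa [DirectSum.decompose_of_mem_same gr hx] at this

omit [GradedAlgebra gr] in
/-- A linear map is defined by its values on monomials. The values are prescribed for all exponents
and have to vanish on the unreduced ones, where the monomial does. -/
theorem exists_linearMap (g : (Fin N → ℕ) → C →ₗ[ℝ] A)
    (hg : ∀ β a, Odd (d a) → 2 ≤ β a → g β = 0) :
    ∃ D : A →ₗ[ℝ] A, ∀ f β, D (s f * mono ξ β) = g β f := by
  let Φ : (ι →₀ C) →ₗ[ℝ] A :=
    Finsupp.lsum ℝ fun α => LinearMap.mulRight ℝ (mono ξ (ex α)) ∘ₗ s.toLinearMap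
  have hΦ : Function.Bijective Φ := F.bijective
  let e := LinearEquiv.ofBijective Φ hΦ
  refine ⟨Finsupp.lsum ℝ (fun α => g (ex α)) ∘ₗ e.symm.toLinearMap, fun f β => ?_⟩
  by_cases hβ : ∀ a, Odd (d a) → β a ≤ 1
  · obtain ⟨α, rfl⟩ := F.exists_index β hβ
    have : e (Finsupp.single α f) = s f * mono ξ (ex α) := by
      simp [e, Φ]
    rw [← this]
    simp
  · push Not at hβ
    obtain ⟨a, ha, h2⟩ := hβ
    rw [mono_eq_zero F.comm F.gen_mem ha h2, hg β a ha h2]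
    simp

/-- A linear map which satisfies the Leibniz rule for products with functions and with generators
is a graded derivation. -/
theorem leibniz {j : ℤ} {D : A →ₗ[ℝ] A} (h0 : ∀ f y, D (s f * y) = D (s f) * y + s f * D y)
    (h1 : ∀ a y, D (ξ a * y) = D (ξ a) * y + (-1 : ℝ) ^ (j * d a) • (ξ a * D y))
    {i : ℤ} {x : A} (hx : x ∈ gr i) (y : A) :
    D (x * y) = D x * y + (-1 : ℝ) ^ (j * i) • (x * D y) := by
  have D1 : D 1 = 0 := by
    have := h0 1 1
    simpa using this
  -- The elements satisfying the Leibniz rule against all `y` are closed under products.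
  have hmul : ∀ {i i' : ℤ} {x x' : A},
      (∀ y, D (x * y) = D x * y + (-1 : ℝ) ^ (j * i) • (x * D y)) →
      (∀ y, D (x' * y) = D x' * y + (-1 : ℝ) ^ (j * i') • (x' * D y)) →
      ∀ y, D (x * x' * y) = D (x * x') * y + (-1 : ℝ) ^ (j * (i + i')) • (x * x' * D y) := by
    intro i i' x x' h h' y
    rw [mul_assoc, h, h', h]
    simp only [mul_add, add_mul, smul_add, mul_smul_comm, smul_mul_assoc, smul_smul,
      NManifold.sign_mul, mul_assoc]
    abel
  have hpow : ∀ a (k : ℕ) y,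
      D (ξ a ^ k * y) = D (ξ a ^ k) * y + (-1 : ℝ) ^ (j * (k * d a)) • (ξ a ^ k * D y) := by
    intro a k
    induction k with
    | zero => simp [D1]
    | succ k ih =>
      intro y
      rw [pow_succ', hmul (h1 a) ih y]
      congr 4
      push_cast
      ring
  have hprod : ∀ {N : ℕ} (F : Fin N → A) (e : Fin N → ℤ),
      (∀ a y, D (F a * y) = D (F a) * y + (-1 : ℝ) ^ (j * e a) • (F a * D y)) →
      ∀ y, D ((List.ofFn F).prod * y) =
        D (List.ofFn F).prod * y + (-1 : ℝ) ^ (j * ∑ a, e a) • ((List.ofFn F).prod * D y) := by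
    intro N F e h
    induction N with
    | zero => simp [D1]
    | succ N ih =>
      rw [List.ofFn_succ, List.prod_cons, Fin.sum_univ_succ]
      exact hmul (h 0) (ih _ _ fun a => h a.succ)
  revert y
  refine F.homogeneous_induction_on (p := fun x => ∀ y, D (x * y) = D x * y +
    (-1 : ℝ) ^ (j * i) • (x * D y)) x hx (by simp) (fun x x' h h' y => ?_) fun f β hβ y => ?_
  · simp only [add_mul, map_add, h, h', smul_add]
    abel
  · have := hmul (i := 0) (x := s f) (by simpa using h0 f)
      (hprod (fun a => ξ a ^ β a) (fun a => β a * d a) fun a => hpow a (β a)) y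
    rw [zero_add, show ∑ a, (β a : ℤ) * d a = i by rw [← hβ, weight]; simp only [mul_comm]] at this
    exact this

/-- A graded derivation vanishing on functions and on generators vanishes. -/
theorem derivation_eq_zero {j : ℤ} {D : A →ₗ[ℝ] A}
    (hD : ∀ i x y, x ∈ gr i → D (x * y) = D x * y + (-1 : ℝ) ^ (j * i) • (x * D y))
    (h0 : ∀ f, D (s f) = 0) (h1 : ∀ a, D (ξ a) = 0) : D = 0 := by
  -- Every monomial other than `1` is, up to sign, a generator times a monomial of lower order.
  have hm : ∀ β, D (mono ξ β) = 0 := by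
    intro β
    induction hk : ∑ a, β a generalizing β with
    | zero =>
      have : β = 0 := by
        ext a
        simpa using (Finset.sum_eq_zero_iff.mp hk) a
      subst this
      simpa using h0 1
    | succ k ih =>
      obtain ⟨a, ha⟩ : ∃ a, β a ≠ 0 := by
        by_contra h
        push Not at h
        simp [h] at hk
      obtain ⟨γ, rfl⟩ := exists_add_single ha
      have hγ : D (mono ξ γ) = 0 := by
        refine ih γ ?_
        simp [Finset.sum_add_distrib] at hk
        exact hk
      have e := congrArg D (mul_mono F.comm F.gen_mem a γ)
      rw [hD _ _ _ (F.gen_mem a), h1, hγ, map_smul] at e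
      simp only [zero_mul, mul_zero, smul_zero, add_zero] at e
      exact (smul_eq_zero.mp e.symm).resolve_left (zpow_ne_zero _ (by norm_num))
  ext x
  refine F.induction_on (p := fun x => D x = 0) x (fun x y h h' => by simp [h, h'])
    fun f β => ?_
  rw [hD 0 _ _ (F.base_mem f), h0, hm]
  simp

/-- The partial derivative by a generator: a derivation of degree `-d a` over the base, which is
`1` on the `a`-th generator and `0` on the others. -/
theorem exists_partial (a : Fin N) : ∃ D : A →ₗ[ℝ] A,
    (∀ f β, D (s f * mono ξ β) = s f * monoDeriv d ξ a β) ∧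
    (∀ f, D (s f) = 0) ∧ (∀ b, D (ξ b) = if a = b then 1 else 0) ∧
    (∀ i x, x ∈ gr i → D x ∈ gr (-d a + i)) ∧
    ∀ i x y, x ∈ gr i → D (x * y) = D x * y + (-1 : ℝ) ^ (-d a * i) • (x * D y) := by
  obtain ⟨D, hD⟩ := F.exists_linearMap
    (fun β => LinearMap.mulRight ℝ (monoDeriv d ξ a β) ∘ₗ s.toLinearMap) fun β b hb h2 => by
      rw [monoDeriv_eq_zero F.comm F.gen_mem a hb h2]
      ext; simp
  replace hD : ∀ f β, D (s f * mono ξ β) = s f * monoDeriv d ξ a β := by simpa using hD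
  have hs : ∀ f, D (s f) = 0 := fun f => by
    simpa [monoDeriv_of_eq_zero] using hD f 0
  have hsmul : ∀ f y, D (s f * y) = s f * D y := by
    intro f y
    refine F.induction_on (p := fun y => D (s f * y) = s f * D y) y
      (fun x y h h' => by simp [mul_add, h, h']) fun g β => ?_
    rw [← mul_assoc, ← map_mul, hD, hD, map_mul, mul_assoc]
  have hm : ∀ β, D (mono ξ β) = monoDeriv d ξ a β := fun β => by simpa using hD 1 β
  have hgen0 : ∀ b β, D (ξ b * mono ξ β) =
      (if a = b then mono ξ β else 0) + (-1 : ℝ) ^ (-d a * d b) • (ξ b * D (mono ξ β)) := by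
    intro b β
    rw [mul_mono F.comm F.gen_mem, map_smul, hm, hm, monoDeriv_mul F.comm F.gen_mem]
  have hgen1 : ∀ b, D (ξ b) = if a = b then 1 else 0 := fun b => by
    have h1 : D 1 = 0 := by simpa using hs 1
    have := hgen0 b 0
    simpa [h1] using this
  have hgen : ∀ b y, D (ξ b * y) = D (ξ b) * y + (-1 : ℝ) ^ (-d a * d b) • (ξ b * D y) := by
    intro b y
    refine F.induction_on (p := fun y => D (ξ b * y) = D (ξ b) * y +
      (-1 : ℝ) ^ (-d a * d b) • (ξ b * D y)) y
      (fun x y h h' => by simp only [mul_add, map_add, h, h', smul_add]; abel) fun g β => ?_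
    rw [← mul_assoc, ← F.base_comm, mul_assoc, hsmul, hgen0, hgen1, hsmul, mul_add,
      mul_smul_comm, ← mul_assoc (s g) (ξ b), F.base_comm g (ξ b), mul_assoc]
    split_ifs <;> simp
  refine ⟨D, hD, hs, hgen1, fun i x hx => ?_, fun i x y hx => ?_⟩
  · refine F.homogeneous_induction_on (p := fun x => D x ∈ gr (-d a + i)) x hx (by simp)
      (fun x y h h' => by rw [map_add]; exact add_mem h h') fun f β hβ => ?_
    rw [hD, ← hβ]
    simpa using SetLike.mul_mem_graded (F.base_mem f) (monoDeriv_mem F.gen_mem a β)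
  · exact F.leibniz (fun f y => by rw [hsmul, hs, zero_mul, zero_add]) hgen hx y

/-- A derivation of the base extends to a derivation of degree `0` which is constant on the
generators. -/
theorem exists_base_derivation (δ : C →ₗ[ℝ] C) (hδ : ∀ f g, δ (f * g) = δ f * g + f * δ g) :
    ∃ D : A →ₗ[ℝ] A,
    (∀ f β, D (s f * mono ξ β) = s (δ f) * mono ξ β) ∧
    (∀ f, D (s f) = s (δ f)) ∧ (∀ b, D (ξ b) = 0) ∧
    (∀ i x, x ∈ gr i → D x ∈ gr i) ∧
    ∀ i x y, x ∈ gr i → D (x * y) = D x * y + x * D y := by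
  obtain ⟨D, hD⟩ := F.exists_linearMap
    (fun β => LinearMap.mulRight ℝ (mono ξ β) ∘ₗ s.toLinearMap ∘ₗ δ) fun β b hb h2 => by
      rw [mono_eq_zero F.comm F.gen_mem hb h2]
      ext; simp
  replace hD : ∀ f β, D (s f * mono ξ β) = s (δ f) * mono ξ β := by simpa using hD
  have hs : ∀ f, D (s f) = s (δ f) := fun f => by simpa using hD f 0
  have δ1 : δ 1 = 0 := by simpa using hδ 1 1
  have hm : ∀ β, D (mono ξ β) = 0 := fun β => by simpa [δ1] using hD 1 β
  have hgen1 : ∀ b, D (ξ b) = 0 := fun b => by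
    have := congrArg D (mul_mono F.comm F.gen_mem b 0)
    simpa [hm] using this
  have hbase : ∀ f y, D (s f * y) = D (s f) * y + s f * D y := by
    intro f y
    refine F.induction_on (p := fun y => D (s f * y) = D (s f) * y + s f * D y) y
      (fun x y h h' => by simp only [mul_add, map_add, h, h']; abel) fun g β => ?_
    rw [← mul_assoc, ← map_mul, hD, hD, hs, hδ]
    simp [add_mul, mul_assoc]
  have hgen : ∀ b y, D (ξ b * y) = D (ξ b) * y + (-1 : ℝ) ^ (0 * d b) • (ξ b * D y) := by
    intro b y
    refine F.induction_on (p := fun y => D (ξ b * y) = D (ξ b) * y +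
      (-1 : ℝ) ^ (0 * d b) • (ξ b * D y)) y
      (fun x y h h' => by simp only [mul_add, map_add, h, h', smul_add]; abel) fun g β => ?_
    rw [← mul_assoc, ← F.base_comm, mul_assoc, mul_mono F.comm F.gen_mem, mul_smul_comm, map_smul,
      hD, hgen1, hD, zero_mul, zero_add, ← mul_assoc, ← F.base_comm, mul_assoc,
      mul_mono F.comm F.gen_mem]
    simp
  refine ⟨D, hD, hs, hgen1, fun i x hx => ?_, fun i x y hx => ?_⟩
  · refine F.homogeneous_induction_on (p := fun x => D x ∈ gr i) x hx (by simp)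
      (fun x y h h' => by rw [map_add]; exact add_mem h h') fun f β hβ => ?_
    rw [hD, ← hβ]
    simpa using SetLike.mul_mem_graded (F.base_mem (δ f)) (mono_mem F.gen_mem β)
  · simpa using F.leibniz (j := 0) hbase hgen hx y

end IsFree

end Derivations

end GradedFree

/-! ### Hadamard's lemma -/

namespace SmoothCoord

open MeasureTheory

/-- Integrals of smooth functions over the unit interval depend smoothly on parameters. The
derivative of the integral is an integral of the same form with values in `E →L[ℝ] F`, so that the
induction on the order of differentiability runs over all `F`. -/
theorem contDiff_integral {E : Type} [NormedAddCommGroup E] [NormedSpace ℝ E]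
    [FiniteDimensional ℝ E] (n : ℕ) : ∀ {F : Type} [NormedAddCommGroup F] [NormedSpace ℝ F]
    [CompleteSpace F] {G : ℝ × E → F}, ContDiff ℝ ∞ G →
    ContDiff ℝ n fun y => ∫ t in (0 : ℝ)..1, G (t, y) := by
  have step : ∀ {F : Type} [NormedAddCommGroup F] [NormedSpace ℝ F]
      [CompleteSpace F] {G : ℝ × E → F}, ContDiff ℝ ∞ G → ∀ y,
      HasFDerivAt (fun y => ∫ t in (0 : ℝ)..1, G (t, y))
        (∫ t in (0 : ℝ)..1, fderiv ℝ G (t, y) ∘L ContinuousLinearMap.inr ℝ ℝ E) y := by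
    intro F _ _ _ G hG y
    have hG' : Continuous (fderiv ℝ G) := hG.continuous_fderiv (by simp)
    have hc : Continuous fun q : ℝ × E => fderiv ℝ G q ∘L ContinuousLinearMap.inr ℝ ℝ E :=
      hG'.clm_comp (continuous_const (y := ContinuousLinearMap.inr ℝ ℝ E))
    have hK : IsCompact (Set.Icc (0 : ℝ) 1 ×ˢ Metric.closedBall y 1) :=
      isCompact_Icc.prod (isCompact_closedBall y 1)
    obtain ⟨K, hK⟩ := hK.exists_bound_of_continuousOn hc.continuousOn
    refine (intervalIntegral.hasFDerivAt_integral_of_dominated_of_fderiv_le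
      (𝕜 := ℝ) (F := fun z t => G (t, z))
      (F' := fun z t => fderiv ℝ G (t, z) ∘L ContinuousLinearMap.inr ℝ ℝ E)
      (bound := fun _ => K) (s := Metric.ball y 1) (Metric.ball_mem_nhds y one_pos) ?_ ?_ ?_ ?_ ?_ ?_)
    · exact Filter.Eventually.of_forall fun z =>
        (hG.continuous.comp (by fun_prop : Continuous fun t : ℝ => (t, z))).aestronglyMeasurable
    · exact (hG.continuous.comp (by fun_prop : Continuous fun t : ℝ => (t, y))).intervalIntegrable _ _
    · exact (hc.comp (by fun_prop : Continuous fun t : ℝ => (t, y))).aestronglyMeasurable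
    · refine Filter.Eventually.of_forall fun t ht z hz => ?_
      rw [Set.uIoc_of_le zero_le_one] at ht
      exact hK (t, z) ⟨⟨ht.1.le, ht.2⟩, Metric.ball_subset_closedBall hz⟩
    · exact intervalIntegrable_const
    · refine Filter.Eventually.of_forall fun t _ z _ => ?_
      have h1 : HasFDerivAt G (fderiv ℝ G (t, z)) (t, z) :=
        (hG.differentiable (by simp)).differentiableAt.hasFDerivAt
      exact h1.comp z (hasFDerivAt_prodMk_right t z)
  induction n with
  | zero =>
    intro F _ _ _ G hG
    rw [Nat.cast_zero, contDiff_zero]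
    exact continuous_iff_continuousAt.mpr fun y => (step hG y).continuousAt
  | succ n ih =>
    intro F _ _ _ G hG
    rw [show ((n + 1 : ℕ) : WithTop ℕ∞) = n + 1 by norm_cast, contDiff_succ_iff_hasFDerivAt]
    refine ⟨_, ih (G := fun q => fderiv ℝ G q ∘L ContinuousLinearMap.inr ℝ ℝ E) ?_, step hG⟩
    exact (hG.fderiv_right (m := ∞) (by simp)).clm_comp contDiff_const

variable {m : ℕ}

/-- Hadamard's lemma in `ℝᵐ`, from `f y - f p = ∫₀¹ f'(p + t (y - p)) (y - p) dt`. -/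
theorem exists_hadamard {f : EuclideanSpace ℝ (Fin m) → ℝ} (hf : ContDiff ℝ ∞ f)
    (p : EuclideanSpace ℝ (Fin m)) : ∃ h : Fin m → EuclideanSpace ℝ (Fin m) → ℝ,
    (∀ l, ContDiff ℝ ∞ (h l)) ∧ ∀ y, f y = f p + ∑ l, (y l - p l) * h l y := by
  have hD : ContDiff ℝ ∞ (fderiv ℝ f) := hf.fderiv_right (m := ∞) (by simp)
  let G : ℝ × EuclideanSpace ℝ (Fin m) → EuclideanSpace ℝ (Fin m) →L[ℝ] ℝ :=
    fun q => fderiv ℝ f (p + q.1 • (q.2 - p))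
  have hG : ContDiff ℝ ∞ G := hD.comp (by fun_prop)
  have hH : ContDiff ℝ ∞ fun y => ∫ t in (0 : ℝ)..1, G (t, y) :=
    contDiff_infty.mpr fun n => contDiff_integral n hG
  refine ⟨fun l y => (∫ t in (0 : ℝ)..1, G (t, y)) (EuclideanSpace.single l 1), fun l =>
    hH.clm_apply contDiff_const, fun y => ?_⟩
  have hy : y - p = ∑ l, (y l - p l) • EuclideanSpace.single l (1 : ℝ) := by
    ext k
    simp [Pi.single_apply]
  have hcont : Continuous fun t : ℝ => G (t, y) :=
    hG.continuous.comp (by fun_prop : Continuous fun t : ℝ => (t, y))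
  have e1 : ∫ t in (0 : ℝ)..1, G (t, y) (y - p) = f y - f p := by
    have := intervalIntegral.integral_eq_sub_of_hasDerivAt (a := 0) (b := 1)
      (f := fun t : ℝ => f (p + t • (y - p))) (f' := fun t => G (t, y) (y - p)) (fun t _ => by
        have h1 : HasFDerivAt f (G (t, y)) (p + t • (y - p)) :=
          (hf.differentiable (by simp)).differentiableAt.hasFDerivAt
        have h2 : HasDerivAt (fun t : ℝ => p + t • (y - p)) (y - p) t := by
          simpa using ((hasDerivAt_id t).smul_const (y - p)).const_add p
        exact h1.comp_hasDerivAt t h2)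
      ((hcont.clm_apply continuous_const).intervalIntegrable _ _)
    simpa using this
  rw [← ContinuousLinearMap.intervalIntegral_apply (hcont.intervalIntegrable _ _)] at e1
  have e2 := congrArg (fun v => (∫ t in (0 : ℝ)..1, G (t, y)) v) hy
  simp only at e2
  rw [e1, map_sum] at e2
  simp only [map_smul, smul_eq_mul] at e2
  linarith

/-! ### Smooth functions on the domain of a chart -/

variable {M : Type u} [TopologicalSpace M]

/-- The expression in the chart `φ` of a function on the open subset `V`, extended by zero outside
`V`. Only its values on `φ '' (V ∩ φ.source)` are meaningful. -/
noncomputable def localRep (φ : OpenPartialHomeomorph M (EuclideanSpace ℝ (Fin m))) {V : Opens M}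
    (f : V → ℝ) : EuclideanSpace ℝ (Fin m) → ℝ :=
  Function.extend Subtype.val f 0 ∘ φ.symm

theorem localRep_symm_mem {φ : OpenPartialHomeomorph M (EuclideanSpace ℝ (Fin m))} {V : Opens M}
    (f : V → ℝ) {y : EuclideanSpace ℝ (Fin m)} (h : φ.symm y ∈ V) :
    localRep φ f y = f ⟨φ.symm y, h⟩ :=
  Subtype.val_injective.extend_apply f 0 ⟨φ.symm y, h⟩

theorem localRep_apply {φ : OpenPartialHomeomorph M (EuclideanSpace ℝ (Fin m))} {V : Opens M}
    (f : V → ℝ) (x : V) (hx : x.1 ∈ φ.source) : localRep φ f (φ x) = f x := by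
  have h : φ.symm (φ x) = x := φ.left_inv hx
  rw [localRep_symm_mem f (h.symm ▸ x.2)]
  congr 1
  exact Subtype.ext h

theorem localRep_add (φ : OpenPartialHomeomorph M (EuclideanSpace ℝ (Fin m))) {V : Opens M}
    (f g : V → ℝ) : localRep φ (f + g) = localRep φ f + localRep φ g := by
  ext y
  have := congrFun (Function.extend_add (Subtype.val : V → M) f g 0 0) (φ.symm y)
  rwa [add_zero] at this

theorem localRep_mul (φ : OpenPartialHomeomorph M (EuclideanSpace ℝ (Fin m))) {V : Opens M}
    (f g : V → ℝ) : localRep φ (f * g) = localRep φ f * localRep φ g := by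
  ext y
  have := congrFun (Function.extend_mul (Subtype.val : V → M) f g 0 0) (φ.symm y)
  rwa [mul_zero] at this

theorem localRep_smul (φ : OpenPartialHomeomorph M (EuclideanSpace ℝ (Fin m))) {V : Opens M}
    (c : ℝ) (f : V → ℝ) : localRep φ (c • f) = c • localRep φ f := by
  ext y
  have := congrFun (Function.extend_smul c (Subtype.val : V → M) f 0) (φ.symm y)
  rwa [smul_zero] at this

theorem eventually_symm_mem {φ : OpenPartialHomeomorph M (EuclideanSpace ℝ (Fin m))}
    {V : Opens M} {x : M} (hx : x ∈ φ.source) (hV : x ∈ V) :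
    ∀ᶠ y in nhds (φ x), y ∈ φ.target ∧ φ.symm y ∈ V := by
  have := (φ.isOpen_inter_preimage_symm V.isOpen).mem_nhds
    (x := φ x) ⟨φ.map_source hx, by simpa [φ.left_inv hx] using hV⟩
  exact this

variable [ChartedSpace (EuclideanSpace ℝ (Fin m)) M]
  {φ : OpenPartialHomeomorph M (EuclideanSpace ℝ (Fin m))}

theorem contDiffAt_localRep (hφ : φ ∈ IsManifold.maximalAtlas (𝓡 m) ∞ M) {V : Opens M}
    (f : C^∞⟮𝓡 m, V; ℝ⟯) (x : V) (hx : x.1 ∈ φ.source) :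
    ContDiffAt ℝ ∞ (localRep φ f) (φ x) := by
  have h1 : ContMDiffAt (𝓡 m) 𝓘(ℝ) ∞ (Function.extend Subtype.val f 0 : M → ℝ) x := by
    rw [← contMDiffAt_subtype_iff]
    refine (f.contMDiff x).congr_of_eventuallyEq (Filter.Eventually.of_forall fun y => ?_)
    exact Subtype.val_injective.extend_apply f 0 y
  have h2 := contMDiffAt_symm_of_mem_maximalAtlas hφ (φ.map_source hx)
  rw [← contMDiffAt_iff_contDiffAt]
  refine ContMDiffAt.comp (φ x) ?_ h2
  rwa [φ.left_inv hx]

theorem contMDiff_comp_chart (hφ : φ ∈ IsManifold.maximalAtlas (𝓡 m) ∞ M) {V : Opens M}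
    (hV : (V : Set M) ⊆ φ.source) {g : EuclideanSpace ℝ (Fin m) → ℝ}
    (hg : ∀ x : V, ContDiffAt ℝ ∞ g (φ x)) : ContMDiff (𝓡 m) 𝓘(ℝ) ∞ fun x : V => g (φ x) := by
  intro x
  have : ContMDiffAt (𝓡 m) 𝓘(ℝ) ∞ (fun x : M => g (φ x)) x :=
    ContMDiffAt.comp x.1 (contMDiffAt_iff_contDiffAt.mpr (hg x))
      (contMDiffAt_of_mem_maximalAtlas hφ (hV x.2))
  exact contMDiffAt_subtype_iff.mpr this

/-- The pullback of a smooth function to a chart domain. -/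
noncomputable def pullback (hφ : φ ∈ IsManifold.maximalAtlas (𝓡 m) ∞ M) {V : Opens M}
    (hV : (V : Set M) ⊆ φ.source) {g : EuclideanSpace ℝ (Fin m) → ℝ} (hg : ContDiff ℝ ∞ g) :
    C^∞⟮𝓡 m, V; ℝ⟯ :=
  ⟨fun x => g (φ x), contMDiff_comp_chart hφ hV fun _ => hg.contDiffAt⟩

theorem contDiff_coord (l : Fin m) : ContDiff ℝ ∞ fun y : EuclideanSpace ℝ (Fin m) => y l :=
  (EuclideanSpace.proj l : EuclideanSpace ℝ (Fin m) →L[ℝ] ℝ).contDiff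

/-- The `l`-th coordinate function of a chart. -/
noncomputable def coord (hφ : φ ∈ IsManifold.maximalAtlas (𝓡 m) ∞ M) {V : Opens M}
    (hV : (V : Set M) ⊆ φ.source) (l : Fin m) : C^∞⟮𝓡 m, V; ℝ⟯ :=
  pullback hφ hV (contDiff_coord l)

/-- The partial derivative of smooth functions on an open subset of a chart domain by the `l`-th coordinate of a chart. -/
noncomputable def partialDeriv (hφ : φ ∈ IsManifold.maximalAtlas (𝓡 m) ∞ M) {V : Opens M}
    (hV : (V : Set M) ⊆ φ.source) (l : Fin m) : C^∞⟮𝓡 m, V; ℝ⟯ →ₗ[ℝ] C^∞⟮𝓡 m, V; ℝ⟯ where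
  toFun f := ⟨fun x => fderiv ℝ (localRep φ f) (φ x) (EuclideanSpace.single l 1),
    contMDiff_comp_chart (g := fun y => fderiv ℝ (localRep φ f) y (EuclideanSpace.single l 1))
      hφ hV fun x => ((contDiffAt_localRep hφ f x (hV x.2)).fderiv_right (m := ∞)
        (by simp)).clm_apply contDiffAt_const⟩
  map_add' f g := by
    ext x
    have hf := (contDiffAt_localRep hφ f x (hV x.2)).differentiableAt (by simp)
    have hg := (contDiffAt_localRep hφ g x (hV x.2)).differentiableAt (by simp)
    change fderiv ℝ (localRep φ (⇑f + ⇑g)) (φ x) _ = _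
    rw [localRep_add, fderiv_add hf hg]
    rfl
  map_smul' c f := by
    ext x
    have hf := (contDiffAt_localRep hφ f x (hV x.2)).differentiableAt (by simp)
    change fderiv ℝ (localRep φ (c • ⇑f)) (φ x) _ = _
    rw [localRep_smul, fderiv_const_smul hf]
    rfl

theorem partialDeriv_mul (hφ : φ ∈ IsManifold.maximalAtlas (𝓡 m) ∞ M) {V : Opens M}
    (hV : (V : Set M) ⊆ φ.source) (l : Fin m) (f g : C^∞⟮𝓡 m, V; ℝ⟯) :
    partialDeriv hφ hV l (f * g) = partialDeriv hφ hV l f * g + f * partialDeriv hφ hV l g := by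
  ext x
  have hf := (contDiffAt_localRep hφ f x (hV x.2)).differentiableAt (by simp)
  have hg := (contDiffAt_localRep hφ g x (hV x.2)).differentiableAt (by simp)
  change fderiv ℝ (localRep φ (⇑f * ⇑g)) (φ x) _ =
    fderiv ℝ (localRep φ f) (φ x) _ * g x + f x * fderiv ℝ (localRep φ g) (φ x) _
  rw [localRep_mul, fderiv_mul hf hg, localRep_apply f x (hV x.2), localRep_apply g x (hV x.2)]
  simp
  ring

theorem partialDeriv_coord (hφ : φ ∈ IsManifold.maximalAtlas (𝓡 m) ∞ M) {V : Opens M}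
    (hV : (V : Set M) ⊆ φ.source) (l k : Fin m) :
    partialDeriv hφ hV l (coord hφ hV k) = if l = k then 1 else 0 := by
  ext x
  have he : localRep φ (coord hφ hV k) =ᶠ[nhds (φ x)]
      (EuclideanSpace.proj k : EuclideanSpace ℝ (Fin m) →L[ℝ] ℝ) := by
    filter_upwards [eventually_symm_mem (hV x.2) x.2] with y hy
    rw [localRep_symm_mem _ hy.2]
    change φ (φ.symm y) k = y k
    rw [φ.right_inv hy.1]
  change fderiv ℝ (localRep φ (coord hφ hV k)) (φ x) _ = _
  rw [he.fderiv_eq, ContinuousLinearMap.fderiv]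
  by_cases h : l = k
  · subst h; simp
  · simp [h, Ne.symm h]

theorem restrict_partialDeriv (hφ : φ ∈ IsManifold.maximalAtlas (𝓡 m) ∞ M) {V W : Opens M}
    (hV : (V : Set M) ⊆ φ.source) (h : W ≤ V) (l : Fin m) (f : C^∞⟮𝓡 m, V; ℝ⟯) :
    ContMDiffMap.restrictRingHom (𝓡 m) 𝓘(ℝ) ℝ h (partialDeriv hφ hV l f) =
      partialDeriv hφ ((SetLike.coe_subset_coe.mpr h).trans hV) l
        (ContMDiffMap.restrictRingHom (𝓡 m) 𝓘(ℝ) ℝ h f) := by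
  ext x
  have he : localRep φ f =ᶠ[nhds (φ x)]
      localRep φ (ContMDiffMap.restrictRingHom (𝓡 m) 𝓘(ℝ) ℝ h f) := by
    filter_upwards [eventually_symm_mem (hV (h x.2)) x.2] with y hy
    rw [localRep_symm_mem _ hy.2, localRep_symm_mem _ (h hy.2)]
    rfl
  change fderiv ℝ (localRep φ f) (φ x) _ = fderiv ℝ (localRep φ _) (φ x) _
  rw [he.fderiv_eq]

/-- Hadamard's lemma: near a point, a smooth function is a constant plus a combination of the
coordinate functions centred at that point. -/
theorem exists_restrict_eq (hφ : φ ∈ IsManifold.maximalAtlas (𝓡 m) ∞ M) {V : Opens M}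
    (hV : (V : Set M) ⊆ φ.source) (f : C^∞⟮𝓡 m, V; ℝ⟯) (p : V) :
    ∃ (W : Opens M) (h : W ≤ V) (_ : p.1 ∈ W) (g : Fin m → C^∞⟮𝓡 m, W; ℝ⟯),
      ContMDiffMap.restrictRingHom (𝓡 m) 𝓘(ℝ) ℝ h f = algebraMap ℝ _ (f p) +
        ∑ l, (coord hφ ((SetLike.coe_subset_coe.mpr h).trans hV) l -
          algebraMap ℝ _ (φ p l)) * g l := by
  -- A bump function makes the local expression of `f` globally smooth on `ℝᵐ` without changing it
  -- near `φ p`.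
  obtain ⟨ε, hε, hball⟩ := Metric.eventually_nhds_iff_ball.mp (eventually_symm_mem (hV p.2) p.2)
  let χ : ContDiffBump (φ p) := ⟨ε / 3, ε / 2, by positivity, by linarith⟩
  have hF : ContDiff ℝ ∞ fun y => χ y * localRep φ f y := by
    rw [contDiff_iff_contDiffAt]
    intro y
    by_cases hy : y ∈ Metric.ball (φ p) ε
    · obtain ⟨h1, h2⟩ := hball y hy
      refine χ.contDiffAt.mul ?_
      have := contDiffAt_localRep hφ f ⟨φ.symm y, h2⟩ (hV h2)
      rwa [φ.right_inv h1] at this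
    · have hd : y ∉ tsupport χ := by
        rw [χ.tsupport_eq]
        intro h
        exact hy (Metric.closedBall_subset_ball (by change ε / 2 < ε; linarith) h)
      refine (contDiffAt_const (c := (0 : ℝ))).congr_of_eventuallyEq ?_
      filter_upwards [notMem_tsupport_iff_eventuallyEq.mp hd] with z hz
      simp [hz]
  obtain ⟨g, hg, hfg⟩ := exists_hadamard hF (φ p)
  let W : Opens M := ⟨φ.source ∩ φ ⁻¹' Metric.ball (φ p) (ε / 3),
    φ.isOpen_inter_preimage Metric.isOpen_ball⟩
  have hWs : ∀ x ∈ W, x ∈ φ.source := fun x hx => hx.1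
  have hWb : ∀ x ∈ W, φ x ∈ Metric.ball (φ p) (ε / 3) := fun x hx => hx.2
  have hW : W ≤ V := by
    intro x hx
    have := (hball (φ x) (Metric.ball_subset_ball (by linarith) (hWb x hx))).2
    rwa [φ.left_inv (hWs x hx)] at this
  have hχ : ∀ x ∈ W, χ (φ x) = 1 := fun x hx =>
    χ.one_of_mem_closedBall (Metric.ball_subset_closedBall (hWb x hx))
  have hpW : p.1 ∈ W := ⟨hV p.2, Metric.mem_ball_self (by positivity)⟩
  refine ⟨W, hW, hpW, fun l => pullback hφ hWs (hg l), ?_⟩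
  ext x
  have := hfg (φ x)
  rw [hχ x x.2, hχ p hpW, one_mul, one_mul, localRep_apply f p (hV p.2),
    localRep_apply f ⟨x, hW x.2⟩ (hV (hW x.2))] at this
  refine this.trans (Eq.symm ?_)
  change ContMDiffMap.coeFnAlgHom (𝕜 := ℝ) (A := ℝ) (algebraMap ℝ _ (f p) + _) x = _
  simp only [map_add, map_sum, map_mul, map_sub, AlgHom.commutes, Pi.add_apply,
    Finset.sum_apply, Pi.mul_apply, Pi.sub_apply]
  rfl

end SmoothCoord

namespace NManifold

variable {n m : ℕ} {r : Fin n → ℕ} {M : Type u} [TopologicalSpace M]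
  [ChartedSpace (EuclideanSpace ℝ (Fin m)) M] {𝓜 : NManifold.{u, v} n m r M}

/-! ### Local arguments -/

/-- A homogeneous function that vanishes locally vanishes. -/
theorem eq_zero_of_forall_res_eq_zero {V : Opens M} {i : ℤ} {x : 𝓜.sec V} (hx : x ∈ 𝓜.gr V i)
    (h : ∀ p ∈ V, ∃ (W : Opens M) (hW : W ≤ V), p ∈ W ∧ 𝓜.res hW x = 0) : x = 0 := by
  let S : Set (Opens M) := {W | ∃ hW : W ≤ V, 𝓜.res hW x = 0}
  have hS : V = sSup S := by
    refine le_antisymm (fun p hp => ?_) (sSup_le fun W hW => hW.1)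
    obtain ⟨W, hW, hpW, h0⟩ := h p hp
    exact (le_sSup (show W ∈ S from ⟨hW, h0⟩)) hpW
  -- The sheaf axiom concerns sections over `sSup S` itself, so the open set is generalized before
  -- the equality `V = sSup S` is substituted.
  have key : ∀ (V' : Opens M) (hV : V' = sSup S) (x' : 𝓜.sec V'), x' ∈ 𝓜.gr V' i →
      (∀ W (hW : W ∈ S), 𝓜.res (hV ▸ le_sSup hW) x' = 0) → x' = 0 := by
    rintro _ rfl x' hx' h'
    exact 𝓜.separated S i x' hx' fun W hW => h' W hW
  exact key V hS x hx fun W hW => hW.2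

theorem eq_of_forall_res_eq {V : Opens M} {i : ℤ} {x y : 𝓜.sec V} (hx : x ∈ 𝓜.gr V i)
    (hy : y ∈ 𝓜.gr V i)
    (h : ∀ p ∈ V, ∃ (W : Opens M) (hW : W ≤ V), p ∈ W ∧ 𝓜.res hW x = 𝓜.res hW y) : x = y := by
  rw [← sub_eq_zero]
  refine eq_zero_of_forall_res_eq_zero (sub_mem hx hy) fun p hp => ?_
  obtain ⟨W, hW, hpW, e⟩ := h p hp
  exact ⟨W, hW, hpW, by rw [map_sub, e, sub_self]⟩

/-- Gluing of homogeneous functions over an open set that equals the union of a family. -/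
theorem exists_glue {V : Opens M} (S : Set (Opens M)) (hS : sSup S = V) (i : ℤ)
    (s : ∀ W : S, 𝓜.sec W.1) (hs : ∀ W, s W ∈ 𝓜.gr W.1 i)
    (h : ∀ W W' : S, 𝓜.res (inf_le_left : W.1 ⊓ W'.1 ≤ W.1) (s W) =
      𝓜.res (inf_le_right : W.1 ⊓ W'.1 ≤ W'.1) (s W')) :
    ∃ x ∈ 𝓜.gr V i, ∀ W : S, 𝓜.res (hS ▸ le_sSup W.2 : W.1 ≤ V) x = s W := by
  subst hS
  exact 𝓜.glue S i s hs h

/-- Families of operators are determined by their values on homogeneous functions. -/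
theorem VF.ext_homogeneous {U : Opens M} {X Y : 𝓜.Op U}
    (h : ∀ (V : {V : Opens M // V ≤ U}) (i : ℤ) (y : 𝓜.gr V.1 i), X V y = Y V y) : X = Y := by
  ext V y
  induction y using DirectSum.Decomposition.inductionOn (𝓜.gr V.1) with
  | zero => simp
  | homogeneous y => exact h V _ y
  | add y z hy hz => rw [map_add, map_add, hy, hz]

/-- Compatible one-forms on the members of a covering that is closed under passing to smaller open
subsets glue. -/
theorem exists_glue_form {U : Opens M} {p : ℤ} (S : Set (Opens M))
    (hdown : ∀ W W', W' ≤ W → W ∈ S → W' ∈ S) (hcov : ∀ x ∈ U, ∃ W ∈ S, W ≤ U ∧ x ∈ W)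
    (η : ∀ W : S, 𝓜.Form W.1 p)
    (hη : ∀ (W W' : S) (h : W'.1 ≤ W.1), resForm h (η W) = η W') :
    ∃ θ : 𝓜.Form U p, ∀ (W : S) (h : W.1 ≤ U), resForm h θ = η W := by
  have hcov' : ∀ V ≤ U, ∀ x ∈ V, ∃ W ∈ S, W ≤ V ∧ x ∈ W := by
    intro V hV x hx
    obtain ⟨W, hW, -, hxW⟩ := hcov x (hV hx)
    exact ⟨W ⊓ V, hdown W _ inf_le_left hW, inf_le_right, hxW, hx⟩
  have hres : ∀ (W W' : S) (h : W'.1 ≤ W.1) (j : ℤ) (Y : 𝓜.VF W.1 j),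
      𝓜.res h ((η W).1 ⟨W.1, le_rfl⟩ j Y) = (η W').1 ⟨W'.1, le_rfl⟩ j (resVF h Y) := by
    intro W W' h j Y
    rw [← hη W W' h]
    exact ((η W).2.2.2 W.1 W'.1 le_rfl h j Y).symm
  -- The value of the glued form on a vector field `Y` is glued from the values of the local forms
  -- on the restrictions of `Y`.
  have hex : ∀ (V : {V : Opens M // V ≤ U}) (j : ℤ) (Y : 𝓜.VF V.1 j), ∃ x ∈ 𝓜.gr V.1 (p + j),
      ∀ (W : S) (h : W.1 ≤ V.1), 𝓜.res h x = (η W).1 ⟨W.1, le_rfl⟩ j (resVF h Y) := by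
    rintro ⟨V, hV⟩ j Y
    have hsup : sSup {W | W ∈ S ∧ W ≤ V} = V := by
      refine le_antisymm (sSup_le fun W hW => hW.2) fun x hx => ?_
      obtain ⟨W, hW, hWV, hxW⟩ := hcov' V hV x hx
      exact (le_sSup (show W ∈ {W | W ∈ S ∧ W ≤ V} from ⟨hW, hWV⟩)) hxW
    obtain ⟨x, hx, hxs⟩ := exists_glue {W | W ∈ S ∧ W ≤ V} hsup (p + j)
      (fun W => (η ⟨W.1, W.2.1⟩).1 ⟨W.1, le_rfl⟩ j (resVF W.2.2 Y))
      (fun W => (η ⟨W.1, W.2.1⟩).2.1 _ _ _ _) (fun W W' => by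
        have h1 := hres ⟨W.1, W.2.1⟩ ⟨W.1 ⊓ W'.1, hdown _ _ inf_le_left W.2.1⟩ inf_le_left j
          (resVF W.2.2 Y)
        have h2 := hres ⟨W'.1, W'.2.1⟩ ⟨W.1 ⊓ W'.1, hdown _ _ inf_le_left W.2.1⟩ inf_le_right j
          (resVF W'.2.2 Y)
        exact h1.trans h2.symm)
    exact ⟨x, hx, fun W h => hxs ⟨W.1, W.2, h⟩⟩
  choose g hg hgS using hex
  have huniq : ∀ (V : {V : Opens M // V ≤ U}) (i : ℤ) (x y : 𝓜.sec V.1), x ∈ 𝓜.gr V.1 i →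
      y ∈ 𝓜.gr V.1 i → (∀ (W : S) (h : W.1 ≤ V.1), 𝓜.res h x = 𝓜.res h y) → x = y := by
    intro V i x y hx hy h
    refine eq_of_forall_res_eq hx hy fun q hq => ?_
    obtain ⟨W, hW, hWV, hqW⟩ := hcov' V.1 V.2 q hq
    exact ⟨W, hWV, hqW, h ⟨W, hW⟩ hWV⟩
  refine ⟨⟨fun V j => ⟨⟨g V j, fun X Y => ?_⟩, fun c X => ?_⟩, fun V h j X => hg _ j X,
    fun V h i j f X => ?_, fun V W h h' j X => ?_⟩, fun W h => ?_⟩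
  · refine huniq V _ _ _ (hg _ _ _) (add_mem (hg _ _ _) (hg _ _ _)) fun W h => ?_
    rw [map_add, hgS, hgS, hgS, ← map_add]
    rfl
  · refine huniq V _ _ _ (hg _ _ _) (Submodule.smul_mem _ _ (hg _ _ _)) fun W h => ?_
    simp only [RingHom.id_apply]
    rw [map_smul, hgS, hgS, ← map_smul]
    rfl
  · have hm := Submodule.smul_mem _ ((-1 : ℝ) ^ (p * i))
      (SetLike.mul_mem_graded f.2 (hg ⟨V, h⟩ j X))
    rw [show i + (p + j) = p + (i + j) by ring] at hm
    refine huniq ⟨V, h⟩ (p + (i + j)) _ _ (hg _ _ _) hm fun W h' => ?_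
    change 𝓜.res h' (g ⟨V, h⟩ (i + j) (lmulVF f X)) = 𝓜.res h' (_ • (f.1 * g ⟨V, h⟩ j X))
    rw [map_smul, map_mul, hgS, hgS]
    have e : resVF h' (lmulVF f X) = lmulVF ⟨𝓜.res h' f.1, 𝓜.res_mem h' i _ f.2⟩ (resVF h' X) := by
      apply Subtype.ext
      ext V y
      simp [resVF, lmulVF, lmulOp, 𝓜.res_res]
    rw [e]
    exact (η W).2.2.1 W.1 le_rfl i j _ _
  · refine huniq ⟨W, h'.trans h⟩ (p + j) _ _ (hg _ _ _)
      (𝓜.res_mem h' _ _ (hg ⟨V, h⟩ j X)) fun W' h1 => ?_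
    change 𝓜.res h1 (g ⟨W, _⟩ j (resVF h' X)) = 𝓜.res h1 (𝓜.res h' (g ⟨V, _⟩ j X))
    rw [𝓜.res_res, hgS, hgS ⟨V, h⟩]
    rfl
  · apply Subtype.ext
    ext V j X
    have hV : V.1 ∈ S := hdown W.1 V.1 V.2 W.2
    have h1 := hgS ⟨V.1, V.2.trans h⟩ j X ⟨V.1, hV⟩ le_rfl
    rw [𝓜.res_self] at h1
    refine Eq.trans h1 ?_
    rw [← hη W ⟨V.1, hV⟩ V.2]
    rfl

namespace PoissonBracket

variable {k : ℤ} (B : 𝓜.PoissonBracket k)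

/-! ### The map `♯` and the differentials -/

/-- Transport of `♯` along an equality of degrees. -/
theorem sharp_congr {U : Opens M} {p p' : ℤ} {η : 𝓜.Form U p} {η' : 𝓜.Form U p'} (hp : p = p')
    (h : η.1 = η'.1) : (B.sharp U p η).1 = (B.sharp U p' η').1 := by
  subst hp
  rw [Subtype.ext h]

theorem sharp_apply {U V : Opens M} (h : V ≤ U) {p b : ℤ} (η : 𝓜.Form U p) {x : 𝓜.sec V}
    (hx : x ∈ 𝓜.gr V b) : (B.sharp U p η).1 ⟨V, h⟩ x =
      -((-1 : ℝ) ^ (p + k * (b + k)) • η.1 ⟨V, h⟩ (b + k) (B.ham V b ⟨x, hx⟩)) :=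
  B.sharpOp_apply h η hx

theorem sharp_add {U : Opens M} {p : ℤ} (η θ : 𝓜.Form U p) :
    B.sharp U p (η + θ) = B.sharp U p η + B.sharp U p θ := by
  refine Subtype.ext (VF.ext_homogeneous fun V i y => ?_)
  have h1 := B.sharp_apply V.2 (η + θ) y.2
  have h2 := B.sharp_apply V.2 η y.2
  have h3 := B.sharp_apply V.2 θ y.2
  refine h1.trans ?_
  simp only [Submodule.coe_add, Pi.add_apply, LinearMap.add_apply, h2, h3, smul_add, neg_add]

theorem sharp_smul {U : Opens M} {p : ℤ} (c : ℝ) (η : 𝓜.Form U p) :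
    B.sharp U p (c • η) = c • B.sharp U p η := by
  refine Subtype.ext (VF.ext_homogeneous fun V i y => ?_)
  have h1 := B.sharp_apply V.2 (c • η) y.2
  have h2 := B.sharp_apply V.2 η y.2
  refine h1.trans ?_
  simp only [Submodule.coe_smul, Pi.smul_apply, LinearMap.smul_apply, h2, smul_neg,
    smul_comm c]

/-- The map `♯` in degree `p`, as a linear map. -/
noncomputable def sharpLinear (U : Opens M) (p : ℤ) : 𝓜.Form U p →ₗ[ℝ] 𝓜.VF U (p + k) where
  toFun := B.sharp U p
  map_add' := B.sharp_add
  map_smul' := B.sharp_smul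

theorem sharp_neg {U : Opens M} {p : ℤ} (η : 𝓜.Form U p) :
    B.sharp U p (-η) = -B.sharp U p η :=
  map_neg (B.sharpLinear U p) η

theorem sharp_zero {U : Opens M} {p : ℤ} : B.sharp U p 0 = 0 :=
  map_zero (B.sharpLinear U p)

theorem sharp_res {U V : Opens M} (h : V ≤ U) (p : ℤ) (η : 𝓜.Form U p) :
    B.sharp V p (resForm h η) = resVF h (B.sharp U p η) := rfl

/-- Right linearity of `♯`, as a map to the shift of the module of vector fields, is its left
anti-linearity up to a sign. -/
theorem sharp_rmulForm {U : Opens M} (i p : ℤ) (f : 𝓜.gr U i) (η : 𝓜.Form U p) :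
    (B.sharp U (i + p) (rmulForm η f)).1 = (rmulShiftVF k (B.sharp U p η) f).1 := by
  simp only [rmulForm, rmulShiftVF, rmulVF, sharp_smul, Submodule.coe_smul, sharp_lmulForm,
    smul_smul, sign_mul]
  rw [sign_congr (i := i * (p + 1) + i) (j := k * i + i * (p + k)) ⟨i - k * i, by ring⟩]

/-- Compatibility says that Hamiltonian vector fields depend on functions as a chain map. -/
theorem compatible_iff_lieVF_ham (Q : 𝓜.HomologicalVF) :
    B.Compatible Q ↔ ∀ (U : Opens M) (a : ℤ) (x : 𝓜.gr U a),
      (Q.lieVF (B.ham U a x)).1 = (B.ham U (1 + a) ⟨Q.app U x.1, Q.app_mem x.2⟩).1 := by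
  constructor
  · intro h U a x
    ext V y
    rw [Q.lieVF_apply]
    have := h V.1 a (𝓜.res V.2 x.1) y (𝓜.res_mem V.2 a _ x.2)
    rw [sub_eq_iff_eq_add]
    simpa [ham, hamOp, Q.app_res] using this
  · intro h U a x y hx
    have := congrFun (h U a ⟨x, hx⟩) ⟨U, le_rfl⟩
    have := LinearMap.congr_fun this y
    rw [Q.lieVF_apply, sub_eq_iff_eq_add] at this
    simpa [ham, hamOp, 𝓜.res_self] using this

/-- The bracket is compatible with `Q` if and only if `♯` anticommutes with the differentials. -/
theorem compatible_iff_sharp_lieForm (Q : 𝓜.HomologicalVF) :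
    B.Compatible Q ↔ ∀ (U : Opens M) (p : ℤ) (η : 𝓜.Form U p),
      (B.sharp U (p + 1) (Q.lieForm η)).1 = -(Q.lieVF (B.sharp U p η)).1 := by
  rw [B.compatible_iff_lieVF_ham]
  constructor
  · intro h U p η
    refine VF.ext_homogeneous fun ⟨V, hV⟩ b y => ?_
    have e1 : 1 + b + k = b + k + 1 := by ring
    have h1 : η.1 ⟨V, hV⟩ (b + k + 1) (Q.lieVF (B.ham V b y)) =
        η.1 ⟨V, hV⟩ (1 + b + k) (B.ham V (1 + b) ⟨Q.app V y, Q.app_mem y.2⟩) :=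
      Form.apply_congr hV η e1.symm (h V b y)
    have h2 := B.sharp_apply hV (Q.lieForm η) y.2
    have h3 := Q.lieForm_apply ⟨V, hV⟩ η (B.ham V b y)
    have h4 := Q.lieVF_apply ⟨V, hV⟩ (B.sharp U p η) y
    rw [B.sharp_apply hV η y.2, B.sharp_apply hV η (Q.app_mem y.2)] at h4
    rw [h1] at h3
    refine (h2.trans (congrArg (fun z => -((-1 : ℝ) ^ (p + 1 + k * (b + k)) • z)) h3)).trans
      (Eq.trans ?_ (congrArg Neg.neg h4).symm)
    change -((-1 : ℝ) ^ (p + 1 + k * (b + k)) • (Q.app V (η.1 ⟨V, hV⟩ (b + k) (B.ham V b y)) - _)) =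
      -(Q.app V (-(_ • η.1 ⟨V, hV⟩ (b + k) (B.ham V b y))) - _)
    generalize η.1 ⟨V, hV⟩ (b + k) (B.ham V b y) = z
    generalize η.1 ⟨V, hV⟩ (1 + b + k) _ = w
    simp only [map_neg, map_smul, smul_sub, smul_neg, smul_smul, sign_mul, neg_sub]
    rw [sign_congr (i := p + 1 + k * (b + k) + p) (j := p + k + (p + k * (1 + b + k)) + 1)
        ⟨-k, by ring⟩,
      sign_congr (i := p + 1 + k * (b + k)) (j := p + k * (b + k) + 1) ⟨0, by ring⟩, ← neg_sign,
      ← neg_sign]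
    simp only [neg_smul]
  · intro h U a x
    have h1 := h U a (dForm x)
    have h2 : (Q.lieForm (dForm x)).1 =
        (-dForm ⟨Q.app U x.1, Q.app_mem x.2⟩ : 𝓜.Form U (1 + a)).1 := Q.lieForm_dForm x
    rw [B.sharp_congr (add_comm a 1) h2, sharp_neg, sharp_dForm, sharp_dForm] at h1
    exact (neg_injective h1).symm

/-! ### Symplectic brackets induce isomorphisms -/

/-- Products of homogeneous functions and Hamiltonian vector fields of homogeneous functions, of
total degree `j`. -/
def hamProducts (U : Opens M) (j : ℤ) : Set (𝓜.Op U) :=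
  {T | ∃ (a b : ℤ) (f : 𝓜.gr U a) (x : 𝓜.gr U b), a + (b + k) = j ∧
    T = lmulOp f.1 (B.hamOp U x.1)}

theorem hamProducts_subset (U : Opens M) (j : ℤ) {T : 𝓜.Op U} (hT : T ∈ B.hamProducts U j) :
    T ∈ 𝓜.VF U j := by
  obtain ⟨a, b, f, x, rfl, rfl⟩ := hT
  exact lmulOp_mem f.2 (B.hamOp_mem x.2)

/-- Products with arbitrary factors are combinations of products with homogeneous factors, of
various degrees. -/
theorem lmulOp_ham_mem_span (U : Opens M) (f x : 𝓜.sec U) :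
    lmulOp f (B.hamOp U x) ∈ Submodule.span ℝ {T | ∃ j, T ∈ B.hamProducts U j} := by
  induction f using DirectSum.Decomposition.inductionOn (𝓜.gr U) with
  | zero =>
    convert Submodule.zero_mem _
    ext V y
    simp [lmulOp]
  | add f g hf hg =>
    convert add_mem hf hg
    ext V y
    simp [lmulOp, add_mul]
  | @homogeneous a f =>
    induction x using DirectSum.Decomposition.inductionOn (𝓜.gr U) with
    | zero =>
      convert Submodule.zero_mem _
      ext V y
      simp [lmulOp]
    | add f g hf hg =>
      convert add_mem hf hg
      ext V y
      simp [lmulOp, mul_add]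
    | @homogeneous b x => exact Submodule.subset_span ⟨_, a, b, f, x, rfl, rfl⟩

/-- If a vector field of degree `j` is a sum of homogeneous operators, then the summands of degree
`j` already add up to it. -/
theorem VF_eq_sum_filter {U : Opens M} {j : ℤ} {X : 𝓜.Op U} (hX : X ∈ 𝓜.VF U j) {ι : Type*}
    (s : Finset ι) (e : ι → ℤ) (T : ι → 𝓜.Op U) (hT : ∀ t, T t ∈ 𝓜.VF U (e t))
    (h : X = ∑ t ∈ s, T t) : X = ∑ t ∈ s with e t = j, T t := by
  refine VF.ext_homogeneous fun V i y => ?_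
  have h1 := hX.1 V.1 V.2 i y y.2
  have h2 : X V y = ∑ t ∈ s, T t V y := by
    rw [h, Finset.sum_apply, LinearMap.sum_apply]
  rw [Finset.sum_apply, LinearMap.sum_apply, Finset.sum_filter]
  rw [← DirectSum.decompose_of_mem_same (𝓜.gr V.1) h1, h2, DirectSum.decompose_sum,
    DFinsupp.finsetSum_apply, AddSubmonoidClass.coe_finsetSum]
  refine Finset.sum_congr rfl fun t _ => ?_
  have ht := (hT t).1 V.1 V.2 i y y.2
  split_ifs with hj
  · rw [hj] at ht
    exact DirectSum.decompose_of_mem_same (𝓜.gr V.1) ht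
  · exact DirectSum.decompose_of_mem_ne (𝓜.gr V.1) ht fun h' => hj (by linarith)

/-- For a symplectic bracket, homogeneous vector fields are locally combinations of homogeneous
multiples of homogeneous Hamiltonian vector fields. -/
theorem IsSymplectic.exists_mem_span {B : 𝓜.PoissonBracket k} (hB : B.IsSymplectic) {U : Opens M}
    {j : ℤ} (X : 𝓜.VF U j) {q : M} (hq : q ∈ U) : ∃ (V : Opens M) (h : V ≤ U), q ∈ V ∧
      (resVF h X).1 ∈ Submodule.span ℝ (B.hamProducts V j) := by
  obtain ⟨V, h, hqV, N, f, x, hX⟩ := hB U j X q hq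
  refine ⟨V, h, hqV, ?_⟩
  have h1 : (resVF h X).1 ∈ Submodule.span ℝ {T | ∃ j, T ∈ B.hamProducts V j} := by
    rw [hX]
    exact sum_mem fun s _ => B.lmulOp_ham_mem_span V (f s) (x s)
  obtain ⟨L, c, T, hT⟩ := Submodule.mem_span_set'.mp h1
  have hT' := fun t => (T t).2
  choose e he using hT'
  rw [VF_eq_sum_filter (resVF h X).2 Finset.univ e (fun t => c t • (T t).1)
    (fun t => Submodule.smul_mem _ _ (B.hamProducts_subset V _ (he t))) hT.symm]
  refine sum_mem fun t ht => Submodule.smul_mem _ _ (Submodule.subset_span ?_)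
  rw [← (Finset.mem_filter.mp ht).2]
  exact he t

/-- A one-form in the kernel of `♯` vanishes on Hamiltonian vector fields, hence on the vector fields
they generate. -/
theorem sharp_injective {B : 𝓜.PoissonBracket k} (hB : B.IsSymplectic) (U : Opens M) (p : ℤ) :
    Function.Injective (B.sharp U p) := by
  have key : ∀ η : 𝓜.Form U p, B.sharp U p η = 0 → η = 0 := by
    intro η hη
    have hham : ∀ (V : Opens M) (h : V ≤ U) (b : ℤ) (y : 𝓜.gr V b),
        η.1 ⟨V, h⟩ (b + k) (B.ham V b y) = 0 := by
      intro V h b y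
      have h1 := B.sharp_apply h η y.2
      rw [hη] at h1
      have h2 := neg_eq_zero.mp h1.symm
      exact (smul_eq_zero.mp h2).resolve_left (zpow_ne_zero _ (by norm_num))
    apply Subtype.ext
    ext V j X
    refine eq_zero_of_forall_res_eq_zero (η.2.1 V.1 V.2 j X) fun q hq => ?_
    obtain ⟨W, hW, hqW, hmem⟩ := hB.exists_mem_span X hq
    refine ⟨W, hW, hqW, ?_⟩
    rw [← η.2.2.2 V.1 W V.2 hW]
    have hspan : ∀ T, T ∈ Submodule.span ℝ (B.hamProducts W j) → ∃ h : T ∈ 𝓜.VF W j,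
        η.1 ⟨W, hW.trans V.2⟩ j ⟨T, h⟩ = 0 := by
      intro T hT
      induction hT using Submodule.span_induction with
      | mem T hT =>
        refine ⟨B.hamProducts_subset W j hT, ?_⟩
        obtain ⟨a, b, f, x, rfl, rfl⟩ := hT
        have := η.2.2.1 W (hW.trans V.2) a (b + k) f (B.ham W b x)
        rw [hham, mul_zero, smul_zero] at this
        exact this
      | zero => exact ⟨zero_mem _, map_zero _⟩
      | add T T' _ _ h h' =>
        obtain ⟨h1, e1⟩ := h
        obtain ⟨h2, e2⟩ := h'
        refine ⟨add_mem h1 h2, ?_⟩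
        have := (η.1 ⟨W, hW.trans V.2⟩ j).map_add ⟨T, h1⟩ ⟨T', h2⟩
        rw [e1, e2, add_zero] at this
        exact this
      | smul c T _ h =>
        obtain ⟨h1, e1⟩ := h
        refine ⟨Submodule.smul_mem _ c h1, ?_⟩
        have := (η.1 ⟨W, hW.trans V.2⟩ j).map_smul c ⟨T, h1⟩
        rw [e1, smul_zero] at this
        exact this
    exact (hspan _ hmem).2
  intro η θ h
  have h0 : η + -θ = 0 := by
    refine key _ ?_
    rw [sharp_add, sharp_neg, h]
    exact add_neg_cancel (B.sharp U p θ)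
  exact (add_neg_eq_zero (a := η) (b := θ)).mp h0

/-- A combination `∑ f {x, ·}` is the image under `♯` of `∑ (-1) ^ |f| f d x`. -/
theorem exists_sharp_eq_of_mem_span {V : Opens M} {p : ℤ} {T : 𝓜.Op V}
    (hT : T ∈ Submodule.span ℝ (B.hamProducts V (p + k))) :
    ∃ η : 𝓜.Form V p, (B.sharp V p η).1 = T := by
  induction hT using Submodule.span_induction with
  | mem T hT =>
    obtain ⟨a, b, f, x, hab, rfl⟩ := hT
    obtain rfl : a + b = p := by linarith
    refine ⟨(-1 : ℝ) ^ a • lmulForm f (dForm x), ?_⟩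
    rw [sharp_smul, Submodule.coe_smul, sharp_lmulForm, sharp_dForm, smul_smul, sign_mul,
      Even.neg_one_zpow ⟨a, rfl⟩, one_smul]
    rfl
  | zero => exact ⟨0, by rw [sharp_zero]; rfl⟩
  | add T T' _ _ h h' =>
    obtain ⟨η, rfl⟩ := h
    obtain ⟨θ, rfl⟩ := h'
    exact ⟨η + θ, by rw [sharp_add]; rfl⟩
  | smul c T _ h =>
    obtain ⟨η, rfl⟩ := h
    exact ⟨c • η, by rw [sharp_smul]; rfl⟩

/-- Local preimages under `♯` are unique by injectivity, and therefore glue. -/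
theorem sharp_surjective {B : 𝓜.PoissonBracket k} (hB : B.IsSymplectic) (U : Opens M) (p : ℤ) :
    Function.Surjective (B.sharp U p) := by
  intro X
  let S : Set (Opens M) := {W | ∃ (h : W ≤ U) (η : 𝓜.Form W p), B.sharp W p η = resVF h X}
  have hS : ∀ W : S, ∃ η : 𝓜.Form W.1 p, B.sharp W.1 p η = resVF W.2.1 X := fun W => W.2.2
  choose η hη using hS
  obtain ⟨θ, hθ⟩ := exists_glue_form (U := U) S
    (fun W W' h hW => ⟨h.trans hW.1, resForm h (η ⟨W, hW⟩), by
      rw [sharp_res, hη ⟨W, hW⟩]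
      rfl⟩)
    (fun q hq => by
      obtain ⟨W, hW, hqW, hmem⟩ := hB.exists_mem_span X hq
      obtain ⟨ζ, hζ⟩ := B.exists_sharp_eq_of_mem_span hmem
      exact ⟨W, ⟨hW, ζ, Subtype.ext hζ⟩, hW, hqW⟩)
    η (fun W W' h => sharp_injective hB W'.1 p (by
      rw [sharp_res, hη, hη]
      rfl))
  refine ⟨θ, Subtype.ext (VF.ext_homogeneous fun V i y => ?_)⟩
  refine eq_of_forall_res_eq ((B.sharp U p θ).2.1 V.1 V.2 i y y.2) (X.2.1 V.1 V.2 i y y.2)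
    fun q hq => ?_
  obtain ⟨W, hW, hqW, hmem⟩ := hB.exists_mem_span (resVF V.2 X) hq
  obtain ⟨ζ, hζ⟩ := B.exists_sharp_eq_of_mem_span hmem
  have hWS : W ∈ S := ⟨hW.trans V.2, ζ, Subtype.ext hζ⟩
  refine ⟨W, hW, hqW, ?_⟩
  rw [← X.2.2.2 V.1 W V.2 hW, ← (B.sharp U p θ).2.2.2 V.1 W V.2 hW]
  have h1 : resVF (hW.trans V.2) (B.sharp U p θ) = resVF (hW.trans V.2) X := by
    rw [← sharp_res, hθ ⟨W, hWS⟩, hη ⟨W, hWS⟩]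
  exact LinearMap.congr_fun (congrFun (congrArg Subtype.val h1) ⟨W, le_rfl⟩) _

end PoissonBracket

end NManifold

/-! ### Local frames of the structure sheaf -/

theorem GradedFree.map_mono {A A' F : Type*} [Ring A] [Ring A'] [FunLike F A A']
    [MonoidHomClass F A A'] (φ : F) {N : ℕ} (ξ : Fin N → A) (β : Fin N → ℕ) :
    φ (mono ξ β) = mono (fun a => φ (ξ a)) β := by
  simp [mono, map_list_prod, List.map_ofFn, Function.comp_def]

namespace GradedFree.IsFree

variable {A : Type*} [Ring A] [Algebra ℝ A] {gr : ℤ → Submodule ℝ A} {C : Type*} [CommRing C]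
  [Algebra ℝ C] {N : ℕ} {ι : Type*} {s : C →ₐ[ℝ] A} {d : Fin N → ℤ} {ξ : Fin N → A}
  {ex : ι → Fin N → ℕ} (F : IsFree gr s d ξ ex)

/-- The combination of the basis monomials with given coefficients. -/
noncomputable def combine (s : C →ₐ[ℝ] A) (ξ : Fin N → A) (ex : ι → Fin N → ℕ) :
    (ι →₀ C) →ₗ[ℝ] A :=
  Finsupp.lsum ℝ fun α => LinearMap.mulRight ℝ (mono ξ (ex α)) ∘ₗ s.toLinearMap

include F in
theorem combine_bijective : Function.Bijective (combine s ξ ex) := F.bijective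

theorem combine_single (α : ι) (f : C) :
    combine s ξ ex (Finsupp.single α f) = s f * mono ξ (ex α) := by
  simp [combine]

/-- `combine` is linear over the base, acting on `A` through `s`. -/
theorem combine_smul (f : C) (c : ι →₀ C) : combine s ξ ex (f • c) = s f * combine s ξ ex c := by
  induction c using Finsupp.induction_linear with
  | zero => simp
  | add c e hc he => rw [smul_add, map_add, map_add, hc, he, mul_add]
  | single α g => rw [Finsupp.smul_single, combine_single, combine_single, smul_eq_mul, map_mul,
      mul_assoc]

/-- Naturality of `combine` under changes of the base. -/
theorem map_combine {A' C' : Type*} [Ring A'] [Algebra ℝ A'] [CommRing C'] [Algebra ℝ C']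
    {s' : C' →ₐ[ℝ] A'} (φ : A →ₐ[ℝ] A') (ψ : C →+* C') (h : ∀ f, φ (s f) = s' (ψ f))
    (c : ι →₀ C) :
    φ (combine s ξ ex c) =
      combine s' (fun a => φ (ξ a)) ex (c.mapRange ψ (map_zero ψ)) := by
  induction c using Finsupp.induction_linear with
  | zero => simp
  | add c e hc he =>
    rw [map_add, map_add, hc, he, Finsupp.mapRange_add (map_add ψ), map_add]
  | single α g =>
    rw [Finsupp.mapRange_single, combine_single, combine_single, map_mul, h, map_mono]

end GradedFree.IsFree

open GradedFree SmoothCoord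

namespace NManifold

variable {n m : ℕ} {r : Fin n → ℕ} {M : Type u} [TopologicalSpace M]
  [ChartedSpace (EuclideanSpace ℝ (Fin m)) M]

/-- Nested ordered products over a finite dependent family are ordered products over a single
index set. -/
theorem exists_flatten (r : Fin n → ℕ) : ∃ (N : ℕ) (e : Fin N ≃ Σ i, Fin (r i)),
    ∀ {A : Type v} [Ring A] (g : (i : Fin n) → Fin (r i) → A),
      (List.ofFn fun i => (List.ofFn fun j => g i j).prod).prod =
        (List.ofFn fun a => g (e a).1 (e a).2).prod := by
  let L : List (Σ i, Fin (r i)) := (List.ofFn fun i => List.ofFn fun j => ⟨i, j⟩).flatten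
  have hL : L.Nodup := by
    rw [List.nodup_flatten]
    constructor
    · intro l hl
      obtain ⟨i, rfl⟩ := (List.mem_ofFn' _ _).mp hl
      exact List.nodup_ofFn.mpr fun j j' h => by simpa using h
    · rw [List.pairwise_ofFn]
      intro i i' h x hx hx'
      obtain ⟨j, rfl⟩ := (List.mem_ofFn' _ _).mp hx
      obtain ⟨j', h'⟩ := (List.mem_ofFn' _ _).mp hx'
      exact h.ne (congrArg Sigma.fst h').symm
  have hmem : ∀ x, x ∈ L := fun x =>
    List.mem_flatten.mpr ⟨_, (List.mem_ofFn' _ _).mpr ⟨x.1, rfl⟩, (List.mem_ofFn' _ _).mpr ⟨x.2, rfl⟩⟩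
  refine ⟨L.length, hL.getEquivOfForallMemList L hmem, fun {A} _ g => ?_⟩
  have h1 : (L.map fun x => g x.1 x.2).prod =
      (List.ofFn fun i => (List.ofFn fun j => g i j).prod).prod := by
    simp [L, List.map_flatten, List.prod_flatten, List.map_ofFn, Function.comp_def]
  rw [← h1]
  congr 1
  refine List.ext_get (by simp) fun a h h' => ?_
  simp only [List.get_eq_getElem, List.getElem_map, List.getElem_ofFn]
  rfl

variable (𝓜 : NManifold.{u, v} n m r M)

/-- Near each point there is a chart of the base together with free generators of the structure
sheaf. -/
theorem exists_frame [IsManifold (𝓡 m) ∞ M] (p : M) : ∃ (U : Opens M)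
    (φ : OpenPartialHomeomorph M (EuclideanSpace ℝ (Fin m))) (N : ℕ) (d : Fin N → ℤ)
    (ξ : Fin N → 𝓜.sec U) (ex : MultiIndex r → Fin N → ℕ),
    p ∈ U ∧ φ ∈ IsManifold.maximalAtlas (𝓡 m) ∞ M ∧ (U : Set M) ⊆ φ.source ∧
    ∀ (V : Opens M) (h : V ≤ U), IsFree (𝓜.gr V) (𝓜.smooth V) d (fun a => 𝓜.res h (ξ a)) ex := by
  obtain ⟨U, hpU, ξ, hξ, hb⟩ := 𝓜.locally_free p
  obtain ⟨N, e, he⟩ := exists_flatten.{v} r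
  let φ := chartAt (EuclideanSpace ℝ (Fin m)) p
  let U' : Opens M := U ⊓ ⟨φ.source, φ.open_source⟩
  have hU' : U' ≤ U := inf_le_left
  refine ⟨U', φ, N, fun a => ((e a).1 : ℤ) + 1, fun a => 𝓜.res hU' (ξ (e a).1 (e a).2),
    fun α a => α.1 (e a).1 (e a).2, ⟨hpU, mem_chart_source _ p⟩,
    IsManifold.chart_mem_maximalAtlas p, fun x hx => hx.2, fun V h => ?_⟩
  refine ⟨𝓜.graded_comm V, 𝓜.smooth_mem V, fun a => 𝓜.res_mem _ _ _ (𝓜.res_mem _ _ _ (hξ _ _)),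
    fun β hβ => ?_, ?_⟩
  · refine ⟨⟨fun i j => β (e.symm ⟨i, j⟩), fun i j hodd => hβ _ ?_⟩, ?_⟩
    · rw [Equiv.apply_symm_apply]
      exact_mod_cast hodd
    · ext a
      simp
  · have key : ∀ α, MultiIndex.monomial (fun i j => 𝓜.res (h.trans hU') (ξ i j)) α =
        mono (fun a => 𝓜.res h (𝓜.res hU' (ξ (e a).1 (e a).2))) fun a => α.1 (e a).1 (e a).2 := by
      intro α
      refine (he _).trans ?_
      simp only [mono, 𝓜.res_res]
    simpa only [key] using hb V (h.trans hU')

variable {𝓜}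

/-! ### Vector fields in coordinates -/

theorem VF.map_one {U : Opens M} {j : ℤ} (X : 𝓜.VF U j) (V : {V : Opens M // V ≤ U}) :
    X.1 V 1 = 0 := by
  have := X.2.2.1 V.1 V.2 0 1 1 SetLike.GradedOne.one_mem
  simpa using this

section Frame

variable {U : Opens M} {φ : OpenPartialHomeomorph M (EuclideanSpace ℝ (Fin m))} {N : ℕ}
  {d : Fin N → ℤ} {ξ : Fin N → 𝓜.sec U} {ex : MultiIndex r → Fin N → ℕ}
  (hφ : φ ∈ IsManifold.maximalAtlas (𝓡 m) ∞ M) (hU : (U : Set M) ⊆ φ.source)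
  (hF : ∀ (V : Opens M) (h : V ≤ U),
    IsFree (𝓜.gr V) (𝓜.smooth V) d (fun a => 𝓜.res h (ξ a)) ex)

include hF

/-- The partial derivatives of functions by the generators, as vector fields. -/
theorem exists_generatorVF (a : Fin N) : ∃ D : 𝓜.VF U (-d a), ∀ (V : Opens M) (h : V ≤ U),
    (∀ f, D.1 ⟨V, h⟩ (𝓜.smooth V f) = 0) ∧
    ∀ b, D.1 ⟨V, h⟩ (𝓜.res h (ξ b)) = if a = b then 1 else 0 := by
  choose D h1 h2 h3 h4 h5 using fun V : {V : Opens M // V ≤ U} => (hF V.1 V.2).exists_partial a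
  refine ⟨⟨D, fun V h => h4 ⟨V, h⟩, fun V h => h5 ⟨V, h⟩, fun V W h h' x => ?_⟩,
    fun V h => ⟨h2 ⟨V, h⟩, h3 ⟨V, h⟩⟩⟩
  have hm : ∀ β, 𝓜.res h' (mono (fun a => 𝓜.res h (ξ a)) β) =
      mono (fun a => 𝓜.res (h'.trans h) (ξ a)) β := fun β => by
    rw [map_mono]
    simp only [𝓜.res_res]
  refine (hF V h).induction_on (p := fun x => D ⟨W, h'.trans h⟩ (𝓜.res h' x) =
    𝓜.res h' (D ⟨V, h⟩ x)) x (fun x y hx hy => by simp only [map_add, hx, hy]) fun f β => ?_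
  rw [h1 ⟨V, h⟩, map_mul, 𝓜.res_smooth, hm, h1 ⟨W, h'.trans h⟩, map_mul, 𝓜.res_smooth, monoDeriv,
    monoDeriv, map_smul, hm]

/-- The partial derivatives of functions by the coordinates of the base, as vector fields. -/
theorem exists_coordVF (l : Fin m) : ∃ D : 𝓜.VF U 0, ∀ (V : Opens M) (h : V ≤ U),
    (∀ f, D.1 ⟨V, h⟩ (𝓜.smooth V f) =
      𝓜.smooth V (partialDeriv hφ ((SetLike.coe_subset_coe.mpr h).trans hU) l f)) ∧
    ∀ b, D.1 ⟨V, h⟩ (𝓜.res h (ξ b)) = 0 := by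
  choose D h1 h2 h3 h4 h5 using fun V : {V : Opens M // V ≤ U} =>
    (hF V.1 V.2).exists_base_derivation
      (partialDeriv hφ ((SetLike.coe_subset_coe.mpr V.2).trans hU) l)
      (partialDeriv_mul hφ _ l)
  refine ⟨⟨D, fun V h i x hx => ?_, fun V h i x y hx => ?_, fun V W h h' x => ?_⟩,
    fun V h => ⟨h2 ⟨V, h⟩, h3 ⟨V, h⟩⟩⟩
  · rw [zero_add]
    exact h4 ⟨V, h⟩ i x hx
  · rw [zero_mul, zpow_zero, one_smul]
    exact h5 ⟨V, h⟩ i x y hx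
  have hm : ∀ β, 𝓜.res h' (mono (fun a => 𝓜.res h (ξ a)) β) =
      mono (fun a => 𝓜.res (h'.trans h) (ξ a)) β := fun β => by
    rw [map_mono]
    simp only [𝓜.res_res]
  refine (hF V h).induction_on (p := fun x => D ⟨W, h'.trans h⟩ (𝓜.res h' x) =
    𝓜.res h' (D ⟨V, h⟩ x)) x (fun x y hx hy => by simp only [map_add, hx, hy]) fun f β => ?_
  rw [h1 ⟨V, h⟩, map_mul, 𝓜.res_smooth, hm, h1 ⟨W, h'.trans h⟩, map_mul, 𝓜.res_smooth, hm,
    restrict_partialDeriv hφ]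

/-- A vector field which kills the coordinates of the base kills all smooth functions: the value
of each coefficient at a point is computed by Hadamard's lemma. -/
theorem VF.smooth_eq_zero {V : Opens M} (hV : V ≤ U) {j : ℤ} (X : 𝓜.VF V j)
    (hX : ∀ l, X.1 ⟨V, le_rfl⟩
      (𝓜.smooth V (coord hφ ((SetLike.coe_subset_coe.mpr hV).trans hU) l)) = 0)
    (f : C^∞⟮𝓡 m, V; ℝ⟯) : X.1 ⟨V, le_rfl⟩ (𝓜.smooth V f) = 0 := by
  obtain ⟨c, hc⟩ := (hF V hV).combine_bijective.2 (X.1 ⟨V, le_rfl⟩ (𝓜.smooth V f))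
  rw [← hc]
  suffices c = 0 by rw [this, map_zero]
  ext α p
  obtain ⟨W, hW, hpW, g, hg⟩ :=
    exists_restrict_eq hφ ((SetLike.coe_subset_coe.mpr hV).trans hU) f p
  choose cg hcg using fun l =>
    (hF W (hW.trans hV)).combine_bijective.2 (X.1 ⟨W, hW⟩ (𝓜.smooth W (g l)))
  have hXW : ∀ l, X.1 ⟨W, hW⟩ (𝓜.smooth W
      (coord hφ ((SetLike.coe_subset_coe.mpr (hW.trans hV)).trans hU) l)) = 0 := by
    intro l
    have := X.2.2.2 V W le_rfl hW
      (𝓜.smooth V (coord hφ ((SetLike.coe_subset_coe.mpr hV).trans hU) l))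
    rw [hX, map_zero, 𝓜.res_smooth] at this
    exact this
  have hconst : ∀ t : ℝ, X.1 ⟨W, hW⟩ (algebraMap ℝ (𝓜.sec W) t) = 0 := fun t => by
    rw [Algebra.algebraMap_eq_smul_one, map_smul, VF.map_one, smul_zero]
  -- On `W`, the vector field sends `f = f(p) + ∑ (x_l - x_l(p)) g_l` to `∑ (x_l - x_l(p)) X(g_l)`.
  have key : c.mapRange (ContMDiffMap.restrictRingHom (𝓡 m) 𝓘(ℝ) ℝ hW) (map_zero _) =
      ∑ l, (coord hφ ((SetLike.coe_subset_coe.mpr (hW.trans hV)).trans hU) l -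
        algebraMap ℝ _ (φ p l)) • cg l := by
    apply (hF W (hW.trans hV)).combine_bijective.1
    have h1 := IsFree.map_combine (ξ := fun a => 𝓜.res hV (ξ a)) (ex := ex) (𝓜.res hW)
      (ContMDiffMap.restrictRingHom (𝓡 m) 𝓘(ℝ) ℝ hW) (𝓜.res_smooth hW) c
    simp only [𝓜.res_res] at h1
    rw [← h1, hc, ← X.2.2.2 V W le_rfl hW, 𝓜.res_smooth, hg, map_add, map_sum, map_add,
      AlgHom.commutes, hconst, zero_add, map_sum, map_sum]
    refine Finset.sum_congr rfl fun l _ => ?_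
    rw [IsFree.combine_smul, hcg, map_mul, X.2.2.1 W hW 0 _ _ (𝓜.smooth_mem W _)]
    rw [map_sub, AlgHom.commutes, map_sub, hXW, hconst]
    simp
  have h2 := congrArg (fun c : MultiIndex r →₀ C^∞⟮𝓡 m, W; ℝ⟯ =>
    ContMDiffMap.coeFnAlgHom (𝕜 := ℝ) (A := ℝ) (c α) ⟨p, hpW⟩) key
  simp only [Finsupp.mapRange_apply, Finsupp.finsetSum_apply, Finsupp.smul_apply, smul_eq_mul,
    map_sum, map_mul, map_sub, AlgHom.commutes, Finset.sum_apply, Pi.mul_apply,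
    Pi.sub_apply] at h2
  refine Eq.trans h2 (Finset.sum_eq_zero fun l _ => ?_)
  rw [show ContMDiffMap.coeFnAlgHom (𝕜 := ℝ) (A := ℝ) (coord hφ
    ((SetLike.coe_subset_coe.mpr (hW.trans hV)).trans hU) l) ⟨p, hpW⟩ = φ p l from rfl]
  simp

/-- Vector fields are determined by their values on coordinates. -/
theorem VF.eq_zero {V : Opens M} (hV : V ≤ U) {j : ℤ} (X : 𝓜.VF V j)
    (hX : ∀ l, X.1 ⟨V, le_rfl⟩
      (𝓜.smooth V (coord hφ ((SetLike.coe_subset_coe.mpr hV).trans hU) l)) = 0)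
    (hX' : ∀ a, X.1 ⟨V, le_rfl⟩ (𝓜.res hV (ξ a)) = 0) : X.1 = 0 := by
  funext ⟨W, hW⟩
  refine (hF W (hW.trans hV)).derivation_eq_zero (j := j) (fun i x y hx => X.2.2.1 W hW i x y hx)
    (fun f => ?_) fun a => ?_
  · refine VF.smooth_eq_zero hφ hU hF (hW.trans hV) (resVF hW X) (fun l => ?_) f
    have := X.2.2.2 V W le_rfl hW
      (𝓜.smooth V (coord hφ ((SetLike.coe_subset_coe.mpr hV).trans hU) l))
    rw [hX, map_zero, 𝓜.res_smooth] at this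
    exact this
  · have := X.2.2.2 V W le_rfl hW (𝓜.res hV (ξ a))
    rw [hX', map_zero, 𝓜.res_res] at this
    exact this

end Frame

/-- Local coordinates `z a` of degree `e a`: vector fields are the combinations of the partial
derivatives `∂ a`, with coefficients their values on coordinates. -/
theorem exists_coordinates [IsManifold (𝓡 m) ∞ M] (p : M) : ∃ (U : Opens M) (K : ℕ)
    (e : Fin K → ℤ) (z : ∀ a, 𝓜.gr U (e a)) (D : ∀ a, 𝓜.VF U (-e a)), p ∈ U ∧
    ∀ (V : Opens M) (h : V ≤ U) (j : ℤ) (X : 𝓜.VF V j),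
      X.1 = ∑ a, lmulOp (X.1 ⟨V, le_rfl⟩ (𝓜.res h (z a).1)) (resVF h (D a)).1 := by
  obtain ⟨U, φ, N, d, ξ, ex, hp, hφ, hU, hF⟩ := 𝓜.exists_frame p
  have hξ : ∀ a, ξ a ∈ 𝓜.gr U (d a) := fun a => by
    simpa [𝓜.res_self] using (hF U le_rfl).gen_mem a
  choose Dξ hDξ using exists_generatorVF hF
  choose Dx hDx using exists_coordVF hφ hU hF
  let e : Fin m ⊕ Fin N → ℤ := Sum.elim (fun _ => 0) d
  let z : ∀ a, 𝓜.gr U (e a) := fun a => match a with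
    | .inl l => ⟨𝓜.smooth U (coord hφ hU l), 𝓜.smooth_mem U _⟩
    | .inr a => ⟨ξ a, hξ a⟩
  let D : ∀ a, 𝓜.VF U (-e a) := fun a => match a with
    | .inl l => ⟨(Dx l).1, by simp [e]⟩
    | .inr a => Dξ a
  have hzx : ∀ (V : Opens M) (h : V ≤ U) l, 𝓜.res h (z (.inl l)).1 =
      𝓜.smooth V (coord hφ ((SetLike.coe_subset_coe.mpr h).trans hU) l) := fun V h l =>
    𝓜.res_smooth h _
  have hDz : ∀ (V : Opens M) (h : V ≤ U) a b,
      (D a).1 ⟨V, h⟩ (𝓜.res h (z b).1) = if a = b then 1 else 0 := by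
    rintro V h (l | a) (l' | b)
    · rw [hzx]
      refine ((hDx l V h).1 _).trans ?_
      rw [partialDeriv_coord]
      by_cases hl : l = l' <;> simp [hl]
    · exact ((hDx l V h).2 b).trans (by simp)
    · rw [hzx]
      exact ((hDξ a V h).1 _).trans (by simp)
    · exact ((hDξ a V h).2 b).trans (by simp)
  -- The coordinates, indexed by `Fin m ⊕ Fin N`, are renumbered by `Fin K`.
  let ε := Fintype.equivFin (Fin m ⊕ Fin N)
  refine ⟨U, _, fun a => e (ε.symm a), fun a => z (ε.symm a), fun a => D (ε.symm a), hp,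
    fun V h j X => ?_⟩
  rw [Equiv.sum_comp ε.symm
    fun a => lmulOp (X.1 ⟨V, le_rfl⟩ (𝓜.res h (z a).1)) (resVF h (D a)).1]
  have hmem : ∀ a, lmulOp (X.1 ⟨V, le_rfl⟩ (𝓜.res h (z a).1)) (resVF h (D a)).1 ∈ 𝓜.VF V j := by
    intro a
    have := lmulOp_mem (X.2.1 V le_rfl (e a) _ (𝓜.res_mem h _ _ (z a).2)) (resVF h (D a)).2
    rwa [show j + e a + -e a = j by ring] at this
  have h0 : ∀ b, (X.1 - ∑ a, lmulOp (X.1 ⟨V, le_rfl⟩ (𝓜.res h (z a).1)) (resVF h (D a)).1)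
      ⟨V, le_rfl⟩ (𝓜.res h (z b).1) = 0 := by
    intro b
    have : ∀ a, lmulOp (X.1 ⟨V, le_rfl⟩ (𝓜.res h (z a).1)) (resVF h (D a)).1 ⟨V, le_rfl⟩
        (𝓜.res h (z b).1) = if a = b then X.1 ⟨V, le_rfl⟩ (𝓜.res h (z b).1) else 0 := by
      intro a
      refine (congrArg₂ (· * ·) (𝓜.res_self _ _) (hDz V h a b)).trans ?_
      by_cases hab : a = b
      · subst hab; simp
      · simp [hab]
    rw [Pi.sub_apply, Finset.sum_apply, LinearMap.sub_apply, LinearMap.sum_apply]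
    simp only [this, Finset.sum_ite_eq', Finset.mem_univ, if_true, sub_self]
  -- The difference of both sides kills all coordinates.
  rw [← sub_eq_zero]
  refine VF.eq_zero hφ hU hF h (⟨_, sub_mem X.2 (sum_mem fun a _ => hmem a)⟩ : 𝓜.VF V j)
    (fun l => ?_) fun a => h0 (.inr a)
  rw [← hzx]
  exact h0 (.inl l)

end NManifold

/-! ### Isomorphisms come from symplectic brackets -/

namespace NManifold

variable {n m : ℕ} {r : Fin n → ℕ} {M : Type u} [TopologicalSpace M]
  [ChartedSpace (EuclideanSpace ℝ (Fin m)) M] {𝓜 : NManifold.{u, v} n m r M}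

namespace PoissonBracket

variable {k : ℤ} (B : 𝓜.PoissonBracket k)

/-- In coordinates `z a` with partial derivatives `D a`, a one-form is `η = ∑ η(D a) d(z a)`, so
that `♯ η` is the combination of the Hamiltonian vector fields of the coordinates with
coefficients `± η(D a)`. -/
theorem sharp_eq_sum {U V : Opens M} {K : ℕ} {e : Fin K → ℤ} {z : ∀ a, 𝓜.gr U (e a)}
    {D : ∀ a, 𝓜.VF U (-e a)}
    (hD : ∀ (V : Opens M) (h : V ≤ U) (j : ℤ) (X : 𝓜.VF V j),
      X.1 = ∑ a, lmulOp (X.1 ⟨V, le_rfl⟩ (𝓜.res h (z a).1)) (resVF h (D a)).1)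
    (h : V ≤ U) {p : ℤ} (η : 𝓜.Form V p) :
    (B.sharp V p η).1 = ∑ a, lmulOp
      ((-1 : ℝ) ^ (p - e a) • η.1 ⟨V, le_rfl⟩ (-e a) (resVF h (D a)))
      (B.hamOp V (𝓜.res h (z a).1)) := by
  refine VF.ext_homogeneous fun ⟨W, hW⟩ b y => ?_
  rw [B.sharp_apply hW η y.2, Finset.sum_apply, LinearMap.sum_apply]
  have hz : ∀ a, 𝓜.res (hW.trans h) (z a).1 ∈ 𝓜.gr W (e a) := fun a => 𝓜.res_mem _ _ _ (z a).2
  have hb : ∀ a, B.br W y.1 (𝓜.res (hW.trans h) (z a).1) ∈ 𝓜.gr W (b + e a + k) := fun a =>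
    B.br_mem W b (e a) _ _ y.2 (hz a)
  have hdeg : ∀ a, b + e a + k + -e a = b + k := fun a => by ring
  -- The coefficients of `{y, ·}` with respect to the partial derivatives are the `{y, z a}`.
  have hham : B.ham W b y = ∑ a, (⟨(lmulVF ⟨_, hb a⟩ (resVF (hW.trans h) (D a))).1,
      hdeg a ▸ (lmulVF ⟨_, hb a⟩ (resVF (hW.trans h) (D a))).2⟩ : 𝓜.VF W (b + k)) := by
    apply Subtype.ext
    rw [AddSubmonoidClass.coe_finsetSum, hD W (hW.trans h) (b + k) (B.ham W b y)]
    refine Finset.sum_congr rfl fun a _ => ?_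
    simp [ham, hamOp, 𝓜.res_self, lmulVF]
  rw [show (⟨y.1, y.2⟩ : 𝓜.gr W b) = y from rfl, hham, map_sum, Finset.smul_sum,
    ← Finset.sum_neg_distrib]
  refine Finset.sum_congr rfl fun a _ => ?_
  have h1 : η.1 ⟨W, hW⟩ (b + k) ⟨(lmulVF ⟨_, hb a⟩ (resVF (hW.trans h) (D a))).1,
      hdeg a ▸ (lmulVF ⟨_, hb a⟩ (resVF (hW.trans h) (D a))).2⟩ = _ :=
    (Form.apply_congr hW η (hdeg a).symm rfl).trans
      (η.2.2.1 W hW _ _ ⟨_, hb a⟩ (resVF (hW.trans h) (D a)))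
  have h2 : 𝓜.res hW (η.1 ⟨V, le_rfl⟩ (-e a) (resVF h (D a))) =
      η.1 ⟨W, hW⟩ (-e a) (resVF (hW.trans h) (D a)) :=
    (η.2.2.2 V W le_rfl hW _ _).symm
  have h3 := η.2.1 W hW _ (resVF (hW.trans h) (D a))
  rw [h1]
  simp only [lmulOp, LinearMap.comp_apply, LinearMap.mulLeft_apply, map_smul, h2, hamOp,
    LinearMap.coe_mk, AddHom.coe_mk, 𝓜.res_res]
  rw [𝓜.graded_comm W _ _ _ _ (hb a) h3, B.skew W b (e a) _ _ y.2 (hz a)]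
  simp only [mul_neg, smul_neg, mul_smul_comm, smul_mul_assoc, smul_smul, sign_mul, neg_neg]
  congr 1
  refine sign_congr ?_
  obtain ⟨s, hs⟩ := Int.even_mul_succ_self (e a)
  exact ⟨k * b + k * k + p * b + p * e a + p * k - s + e a, by linear_combination -hs⟩

/-- If `♯` is surjective, vector fields are images of one-forms, and these are locally combinations of
the differentials of coordinates. -/
theorem isSymplectic_of_sharp_surjective [IsManifold (𝓡 m) ∞ M]
    (hB : ∀ U p, Function.Surjective (B.sharp U p)) : B.IsSymplectic := by
  intro U j X q hq
  obtain ⟨U₀, K, e, z, D, hq₀, hD⟩ := 𝓜.exists_coordinates q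
  obtain ⟨p, rfl⟩ : ∃ p, j = p + k := ⟨j - k, by ring⟩
  obtain ⟨η, rfl⟩ := hB U p X
  exact ⟨U ⊓ U₀, inf_le_left, ⟨hq, hq₀⟩, K, _, _,
    B.sharp_eq_sum hD inf_le_right (resForm inf_le_left η)⟩

theorem isSymplectic_iff_sharp_bijective [IsManifold (𝓡 m) ∞ M] :
    B.IsSymplectic ↔ ∀ U p, Function.Bijective (B.sharp U p) :=
  ⟨fun h U p => ⟨sharp_injective h U p, sharp_surjective h U p⟩,
    fun h => B.isSymplectic_of_sharp_surjective fun U p => (h U p).2⟩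

end PoissonBracket

end NManifold

theorem mainTheorem2 {n m : ℕ} {r : Fin n → ℕ} {M : Type u} [TopologicalSpace M]
    [T2Space M] [SecondCountableTopology M] [ChartedSpace (EuclideanSpace ℝ (Fin m)) M]
    [IsManifold (𝓡 m) ∞ M] (𝓜 : NManifold.{u, v} n m r M) (Q : 𝓜.HomologicalVF)
    (B : 𝓜.PoissonBracket (-(n : ℤ))) :
    (B.IsSymplecticLie Q ↔ NManifold.IsLeftDGAntiIso Q B.sharp) ∧
    (B.IsSymplecticLie Q ↔ NManifold.IsRightDGIso Q B.sharp) := by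
  have hC := B.compatible_iff_sharp_lieForm Q
  have hS := B.isSymplectic_iff_sharp_bijective
  constructor
  · constructor
    · exact fun h =>
        { map_add := fun U p => B.sharp_add
          map_res := fun h => B.sharp_res h
          map_lmul := fun U i p => B.sharp_lmulForm
          map_differential := hC.mp h.1
          bijective := hS.mp h.2 }
    · exact fun h => ⟨hC.mpr h.map_differential, hS.mpr h.bijective⟩
  · constructor
    · exact fun h =>
        { map_add := fun U p => B.sharp_add
          map_res := fun h => B.sharp_res h
          map_rmul := fun U => B.sharp_rmulForm
          map_differential := fun U p η => by
            rw [B.sharp_neg]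
            exact neg_eq_iff_eq_neg.mpr (hC.mp h.1 U p η)
          bijective := hS.mp h.2 }
    · refine fun h => ⟨hC.mpr fun U p η => ?_, hS.mpr h.bijective⟩
      have := h.map_differential U p η
      rw [B.sharp_neg] at this
      exact neg_eq_iff_eq_neg.mp this
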